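/- **Setting.** Let $N,K\ge 0$ be integers, let $(x^i,y^i)_{i=1}^N$ be training data with inputs $x^i\in\mathcal X$, labels $y^i\in\mathcal Y$, let $\mathcal Y(x)\subseteq\mathcal Y$ be the finite set of feasible labels of an input $x$, and let $\Delta\ell_i(y)\in\mathbb R$ be the loss of label $y$ on example $i$ (for example the Hamming loss). Throughout, $y\ne y^i$ means $y\in\mathcal Y(x^i)\setminus\{y^i\}$. Let $f:\mathcal X\times\mathcal Y\to\mathbb R^K$, $F(x,y;w)=w^\top f(x,y)$, $\Delta f_i(y)=f(x^i,y^i)-f(x^i,y)$ with components $\Delta f_i^k(y)$, $\Delta F_i(y;w)=w^\top\Delta f_i(y)$, $U(\xi)=C\sum_{i=1}^N\xi_i$ with $C\in\mathbb R$, and let the prior be $p_0(w)=\prod_{k=1}^K\frac{\sqrt\lambda}{2}e^{-\sqrt\lambda|w_k|}$ with $\lambda>0$. For $S\subseteq\mathbb R^N$ let $\mathrm{P1}(S)$ be the problem $$\min_{p,\;\xi\in S}\ KL(p\,\|\,p_0)+U(\xi)\quad\text{s.t.}\quad \int p(w)\,[\Delta F_i(y;w)-\Delta\ell_i(y)]\,dw\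 \ge\ -\xi_i\quad\forall i,\ \forall y\neq y^i,$$ over probability distributions $p$ of $w\in\mathbb R^K$ under which all $\Delta F_i(y;\cdot)$, $y\neq y^i$, are integrable. Its Lagrangian is $L(p,\xi,\alpha)=KL(p\|p_0)+U(\xi)-\sum_{i,y\ne y^i}\alpha_i(y)\big(\int p(w)[\Delta F_i(y;w)-\Delta\ell_i(y)]\,dw+\xi_i\big)$. A vector $\alpha\ge0$ is a *Lagrange multiplier* if $(p,\xi,\alpha)$ is a saddle point of $L$ for some such $p$ and some $\xi\in S$. Let $$Z(\alpha)=\int p_0(w)\exp\Big\{\sum_{i,y\ne y^i}\alpha_i(y)[\Delta F_i(y;w)-\Delta\ell_i(y)]\Big\}dw\in(0,\infty],\qquad p_\alpha(w)=\frac{1}{Z(\alpha)}p_0(w)\exp\Big\{\sum_{i,y\ne y^i}\alpha_i(y)[\Delta F_i(y;w)-\Delta\ell_i(y)]\Big\},$$ $U^\star_S(\alpha)=\sup_{\xi\in S}\big(\sum_{i,y\ne y^i}\alpha_i(y)\xi_i-U(\xi)\big)$, and let $\mathrm{D1}(S)$ be the problem $\max_{\alpha\ge0}\,-\log Z(\alpha)-U^\star_S(\alpha)$,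 whose solutions are the maximizers at which the objective is not $-\infty$. Put $\eta_k=\sum_{i,y\ne y^i}\alpha_i(y)\,\Delta f_i^k(y)$. **Theorem 5 (Laplace MaxEnDNet: a sparse M³N).** 1. For all real $\alpha$: if $\eta_k^2<\lambda$ for all $k$, then $Z(\alpha)=\exp\big\{-\sum_{i,y\ne y^i}\alpha_i(y)\Delta\ell_i(y)\big\}\prod_{k=1}^K\frac{\lambda}{\lambda-\eta_k^2}$; otherwise $Z(\alpha)=\infty$. 2. Let $S=\mathbb R^N$. Then $\alpha$ solves $\mathrm{D1}(S)$ if and only if $\alpha$ is a Lagrange multiplier, if and only if $\alpha$ solves $$\max_\alpha\ \sum_{i,y\ne y^i}\alpha_i(y)\Delta\ell_i(y)-\sum_{k=1}^K\log\frac{\lambda}{\lambda-\eta_k^2}\quad\text{s.t.}\quad \sum_{y\ne y^i}\alpha_i(y)=C\ \ \forall i,\quad \alpha_i(y)\ge0\ \ \forall i,\,\forall y\ne y^i,\quad \eta_k^2<\lambda\ \ \forall k .$$ If $\alpha$ solves this problem, then $p_\alpha$ (with some $\xi$) solves $\mathrm{P1}(S)$, and every solution of $\mathrm{P1}(S)$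 has $p=p_\alpha$. If $\mathrm{P1}(S)$ has a solution, then this problem has one. 3. If the slack variables are required to be nonnegative, $S=\{\xi:\xi_i\ge0\ \forall i\}$, all assertions of part 2 hold with the constraint $\sum_{y\ne y^i}\alpha_i(y)=C$ replaced by $\sum_{y\ne y^i}\alpha_i(y)\le C$. -/

import Mathlib

open MeasureTheory InformationTheory
open scoped ENNReal

noncomputable section

namespace MaxEnDNet

/-- Supervised training data for structured prediction: `N` labelled examples `(x i, y i)`, the
finite set `labels u` of feasible structured labels of an input `u`, and the loss `loss i y` of
predicting `y` on example `i`. (The Hamming loss is the case where the labels are tuples and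
`loss i y = hammingDist y (y i)`.) -/
structure TrainingData (X Y : Type*) (N : ℕ) where
  x : Fin N → X
  y : Fin N → Y
  labels : X → Finset Y
  loss : Fin N → Y → ℝ

variable {X Y : Type*} [DecidableEq Y] {N K : ℕ}

/-- The feasible labels of example `i` other than the true one, over which every sum and every
constraint ranges. -/
def TrainingData.rivals (T : TrainingData X Y N) (i : Fin N) : Finset Y :=
  (T.labels (T.x i)).erase (T.y i)

/-- The margin `ΔF_i(y; w) = F(x_i, y_i; w) - F(x_i, y; w)` of a discriminant function `F`. -/
def margin (T : TrainingData X Y N) (F : X → Y → (Fin K → ℝ) → ℝ)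
    (i : Fin N) (y : Y) (w : Fin K → ℝ) : ℝ :=
  F (T.x i) (T.y i) w - F (T.x i) y w

/-- The prior distribution with Lebesgue density `p₀`. -/
def prior (p₀ : (Fin K → ℝ) → ℝ) : Measure (Fin K → ℝ) :=
  volume.withDensity fun w => ENNReal.ofReal (p₀ w)

/-- The parameter distributions that are considered: probability measures on the weight space for
which all expected margins are finite. -/
def Admissible (T : TrainingData X Y N) (F : X → Y → (Fin K → ℝ) → ℝ)
    (P : Measure (Fin K → ℝ)) : Prop :=
  IsProbabilityMeasure P ∧ ∀ i, ∀ y ∈ T.rivals i, Integrable (margin T F i y) P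

/-- The left-hand side of the expected margin constraint
`∫ p(w) [ΔF_i(y; w) - Δℓ_i(y)] dw + ξ_i ≥ 0`. -/
def constraintValue (T : TrainingData X Y N) (F : X → Y → (Fin K → ℝ) → ℝ)
    (P : Measure (Fin K → ℝ)) (ξ : Fin N → ℝ) (i : Fin N) (y : Y) : ℝ :=
  (∫ w, (margin T F i y w - T.loss i y) ∂P) + ξ i

/-- Feasibility in the primal problem, with slack variables ranging over the set `S`. -/
def PrimalFeasible (T : TrainingData X Y N) (F : X → Y → (Fin K → ℝ) → ℝ)
    (S : Set (Fin N → ℝ)) (P : Measure (Fin K → ℝ)) (ξ : Fin N → ℝ) : Prop :=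
  Admissible T F P ∧ ξ ∈ S ∧ ∀ i, ∀ y ∈ T.rivals i, 0 ≤ constraintValue T F P ξ i y

/-- The primal objective `KL(P ‖ P₀) + U(ξ)`. -/
def primalObjective (p₀ : (Fin K → ℝ) → ℝ) (U : (Fin N → ℝ) → ℝ)
    (P : Measure (Fin K → ℝ)) (ξ : Fin N → ℝ) : EReal :=
  (klDiv P (prior p₀) : EReal) + (U ξ : EReal)

/-- `(P, ξ)` solves the maximum entropy discrimination Markov network problem: it minimizes
`KL(P ‖ P₀) + U(ξ)` under the expected margin constraints. -/
def IsPrimalSolution (T : TrainingData X Y N) (F : X → Y → (Fin K → ℝ) → ℝ)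
    (p₀ : (Fin K → ℝ) → ℝ) (U : (Fin N → ℝ) → ℝ) (S : Set (Fin N → ℝ))
    (P : Measure (Fin K → ℝ)) (ξ : Fin N → ℝ) : Prop :=
  PrimalFeasible T F S P ξ ∧
    ∀ P' ξ', PrimalFeasible T F S P' ξ' →
      primalObjective p₀ U P ξ ≤ primalObjective p₀ U P' ξ'

/-- Nonnegativity of the multipliers `α_i(y)`, for all `i` and all `y ≠ y_i`. -/
def MultNonneg (T : TrainingData X Y N) (α : Fin N → Y → ℝ) : Prop :=
  ∀ i, ∀ y ∈ T.rivals i, 0 ≤ α i y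

/-- The Lagrangian
`KL(P ‖ P₀) + U(ξ) - ∑_{i, y ≠ y_i} α_i(y) (∫ [ΔF_i(y; w) - Δℓ_i(y)] dP(w) + ξ_i)`. -/
def lagrangian (T : TrainingData X Y N) (F : X → Y → (Fin K → ℝ) → ℝ)
    (p₀ : (Fin K → ℝ) → ℝ) (U : (Fin N → ℝ) → ℝ)
    (P : Measure (Fin K → ℝ)) (ξ : Fin N → ℝ) (α : Fin N → Y → ℝ) : EReal :=
  (klDiv P (prior p₀) : EReal) +
    ((U ξ - ∑ i, ∑ y ∈ T.rivals i, α i y * constraintValue T F P ξ i y : ℝ) : EReal)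

/-- `(P, ξ, α)` is a saddle point of the Lagrangian: it is minimal in `(P, ξ)` and maximal in the
nonnegative multipliers `α`. -/
def IsSaddlePoint (T : TrainingData X Y N) (F : X → Y → (Fin K → ℝ) → ℝ)
    (p₀ : (Fin K → ℝ) → ℝ) (U : (Fin N → ℝ) → ℝ) (S : Set (Fin N → ℝ))
    (P : Measure (Fin K → ℝ)) (ξ : Fin N → ℝ) (α : Fin N → Y → ℝ) : Prop :=
  Admissible T F P ∧ ξ ∈ S ∧ MultNonneg T α ∧
    (∀ β, MultNonneg T β → lagrangian T F p₀ U P ξ β ≤ lagrangian T F p₀ U P ξ α) ∧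
    (∀ P' ξ', Admissible T F P' → ξ' ∈ S →
      lagrangian T F p₀ U P ξ α ≤ lagrangian T F p₀ U P' ξ' α)

/-- `α` is a vector of Lagrange multipliers for the expected margin constraints. -/
def IsLagrangeMultiplier (T : TrainingData X Y N) (F : X → Y → (Fin K → ℝ) → ℝ)
    (p₀ : (Fin K → ℝ) → ℝ) (U : (Fin N → ℝ) → ℝ) (S : Set (Fin N → ℝ))
    (α : Fin N → Y → ℝ) : Prop :=
  ∃ P ξ, IsSaddlePoint T F p₀ U S P ξ α

/-- The unnormalized posterior density
`p₀(w) exp (∑_{i, y ≠ y_i} α_i(y) [ΔF_i(y; w) - Δℓ_i(y)])`. -/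
def unnormalizedPosterior (T : TrainingData X Y N) (F : X → Y → (Fin K → ℝ) → ℝ)
    (p₀ : (Fin K → ℝ) → ℝ) (α : Fin N → Y → ℝ) (w : Fin K → ℝ) : ℝ :=
  p₀ w * Real.exp (∑ i, ∑ y ∈ T.rivals i, α i y * (margin T F i y w - T.loss i y))

/-- The normalization factor `Z(α)`, which may be infinite. -/
def normalizer (T : TrainingData X Y N) (F : X → Y → (Fin K → ℝ) → ℝ)
    (p₀ : (Fin K → ℝ) → ℝ) (α : Fin N → Y → ℝ) : ℝ≥0∞ :=
  ∫⁻ w, ENNReal.ofReal (unnormalizedPosterior T F p₀ α w)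

/-- The distribution `p(w) = Z(α)⁻¹ p₀(w) exp (∑ α_i(y) [ΔF_i(y; w) - Δℓ_i(y)])`. -/
def posterior (T : TrainingData X Y N) (F : X → Y → (Fin K → ℝ) → ℝ)
    (p₀ : (Fin K → ℝ) → ℝ) (α : Fin N → Y → ℝ) : Measure (Fin K → ℝ) :=
  volume.withDensity fun w =>
    ENNReal.ofReal (unnormalizedPosterior T F p₀ α w) / normalizer T F p₀ α

/-- The conjugate `U⋆(α) = sup_ξ (∑_{i, y ≠ y_i} α_i(y) ξ_i - U(ξ))`, with `ξ` ranging over `S`. -/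
def slackConjugate (T : TrainingData X Y N) (U : (Fin N → ℝ) → ℝ) (S : Set (Fin N → ℝ))
    (α : Fin N → Y → ℝ) : EReal :=
  ⨆ ξ ∈ S, ((∑ i, ∑ y ∈ T.rivals i, α i y * ξ i - U ξ : ℝ) : EReal)

/-- The general dual objective `-log Z(α) - U⋆(α)`, with value `-∞` where `Z(α)` or `U⋆(α)` is
infinite. -/
def dualObjective (T : TrainingData X Y N) (F : X → Y → (Fin K → ℝ) → ℝ)
    (p₀ : (Fin K → ℝ) → ℝ) (U : (Fin N → ℝ) → ℝ) (S : Set (Fin N → ℝ))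
    (α : Fin N → Y → ℝ) : EReal :=
  -ENNReal.log (normalizer T F p₀ α) - slackConjugate T U S α

/-- `α` solves the general dual problem: maximize `-log Z(α) - U⋆(α)` over `α ≥ 0`. The objective
is required to be different from `-∞` at a solution. -/
def IsDualSolution (T : TrainingData X Y N) (F : X → Y → (Fin K → ℝ) → ℝ)
    (p₀ : (Fin K → ℝ) → ℝ) (U : (Fin N → ℝ) → ℝ) (S : Set (Fin N → ℝ))
    (α : Fin N → Y → ℝ) : Prop :=
  MultNonneg T α ∧ dualObjective T F p₀ U S α ≠ ⊥ ∧
    ∀ β, MultNonneg T β → dualObjective T F p₀ U S β ≤ dualObjective T F p₀ U S α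

/-- The linear discriminant function `F(x, y; w) = wᵀ f(x, y)`. -/
def linearDiscriminant (f : X → Y → Fin K → ℝ) (x : X) (y : Y) (w : Fin K → ℝ) : ℝ :=
  ∑ k, w k * f x y k

/-- The linear slack function `U(ξ) = C ∑_i ξ_i`. -/
def linearSlack (C : ℝ) (ξ : Fin N → ℝ) : ℝ := C * ∑ i, ξ i

/-- The density `∏_k (√lam / 2) exp (-√lam |w_k|)` of the Laplace prior. -/
def laplaceDensity (lam : ℝ) (w : Fin K → ℝ) : ℝ :=
  ∏ k, (Real.sqrt lam / 2 * Real.exp (-(Real.sqrt lam * |w k|)))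

/-- `η_k = ∑_{i, y ≠ y_i} α_i(y) Δf_i^k(y)`, where `Δf_i^k(y) = f_k(x_i, y_i) - f_k(x_i, y)`. -/
def eta (T : TrainingData X Y N) (f : X → Y → Fin K → ℝ) (α : Fin N → Y → ℝ) (k : Fin K) : ℝ :=
  ∑ i, ∑ y ∈ T.rivals i, α i y * (f (T.x i) (T.y i) k - f (T.x i) y k)

/-- The weighted loss `∑_{i, y ≠ y_i} α_i(y) Δℓ_i(y)`. -/
def weightedLoss (T : TrainingData X Y N) (α : Fin N → Y → ℝ) : ℝ :=
  ∑ i, ∑ y ∈ T.rivals i, α i y * T.loss i y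

/-- The Laplace dual objective
`∑_{i, y ≠ y_i} α_i(y) Δℓ_i(y) - ∑_k log (lam / (lam - η_k²))`. -/
def laplaceDualObjective (T : TrainingData X Y N) (f : X → Y → Fin K → ℝ) (lam : ℝ)
    (α : Fin N → Y → ℝ) : ℝ :=
  weightedLoss T α - ∑ k, Real.log (lam / (lam - eta T f α k ^ 2))

/-- The feasible set of the Laplace dual problem: `α ≥ 0`, `∑_{y ≠ y_i} α_i(y) = C` for all `i`,
and `η_k² < lam` for all `k`. -/
def laplaceDualSet (T : TrainingData X Y N) (f : X → Y → Fin K → ℝ) (lam C : ℝ) :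
    Set (Fin N → Y → ℝ) :=
  {α | MultNonneg T α ∧ (∀ i, ∑ y ∈ T.rivals i, α i y = C) ∧ ∀ k, eta T f α k ^ 2 < lam}

/-- The variant of the feasible set with `∑_{y ≠ y_i} α_i(y) ≤ C` for all `i`. -/
def laplaceDualSetLE (T : TrainingData X Y N) (f : X → Y → Fin K → ℝ) (lam C : ℝ) :
    Set (Fin N → Y → ℝ) :=
  {α | MultNonneg T α ∧ (∀ i, ∑ y ∈ T.rivals i, α i y ≤ C) ∧ ∀ k, eta T f α k ^ 2 < lam}

/-- `α` maximizes the Laplace dual objective over the set `A`. -/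
def SolvesLaplaceDual (T : TrainingData X Y N) (f : X → Y → Fin K → ℝ) (lam : ℝ)
    (A : Set (Fin N → Y → ℝ)) (α : Fin N → Y → ℝ) : Prop :=
  α ∈ A ∧ IsMaxOn (laplaceDualObjective T f lam) A α

end MaxEnDNet

end

namespace MaxEnDNet

/-! ### Exponential moments of the Laplace prior -/

/-! For fixed multipliers, minimizing the Lagrangian over distributions is Gibbs' variational
problem. The Laplace prior has a finite exponential moment at `η` exactly on the open cube `η_k² <
lam`, where it factors over the coordinates. On the cube, `klDiv_sub_pairing_eq` writes the `P`-part
of the Lagrangian as the dual objective plus the relative entropy of `P` to the tilt of the prior by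
`η`. Hence the tilt, which is the posterior, is the unique minimizer, and weak duality carries a
relative entropy as remainder (`laplaceDualObjective_add_klDiv_le`), which gives uniqueness in the
primal problem.

The slack function is linear and `S` is a cone, so its conjugate is `0` or `∞`. Its domain is given
by `∑ α_i(y) = C` or `∑ α_i(y) ≤ C`; `IsSlackCone` collects what both cases share.

No constraint qualification is needed to pass from a dual solution `α` to a saddle point. The
gradient of the dual objective at `α` is minus the expected margin excess `c` of the tilt, and the
cube is open. So `α` minimizes the linear function `pairing T · c` over all nonnegative vectors in
the conjugate's domain. This linear program splits over the examples and is solved by hand; its dual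
solution is the optimal slack vector, and equality of the two values is complementary slackness
(`exists_complementary_slack`).

Conversely, multipliers outside the open cube make the Lagrangian unbounded below. By
`exists_tilt_mean_ray`, tilts with mean `m` along a ray have entropy below `√lam ‖m‖₁` by an
arbitrarily large logarithmic amount, so even the boundary of the cube is excluded.

The exponential of the dual objective extends continuously by zero to the boundary of the cube, so a
nonempty dual feasible set contains a maximizer. If it is empty while the conjugate has a nonempty
domain, Hahn-Banach separates the attainable `η` from the cube; along the separating ray of means
the primal objective tends to `-∞`, so the primal problem has no solution. -/

theorem sq_lt_iff_neg_sqrt_lt_and_lt_sqrt {lam t : ℝ} :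
    t ^ 2 < lam ↔ -Real.sqrt lam < t ∧ t < Real.sqrt lam := by
  rw [← abs_lt, ← Real.sqrt_lt_sqrt_iff (sq_nonneg t), Real.sqrt_sq_eq_abs]

theorem lintegral_laplace_mul_exp_of_lt {lam t : ℝ} (hlam : 0 < lam) (ht : t ^ 2 < lam) :
    ∫⁻ w : ℝ, ENNReal.ofReal
      (Real.sqrt lam / 2 * Real.exp (-(Real.sqrt lam * |w|)) * Real.exp (t * w)) =
      ENNReal.ofReal (lam / (lam - t ^ 2)) := by
  obtain ⟨h1, h2⟩ := sq_lt_iff_neg_sqrt_lt_and_lt_sqrt.1 ht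
  set s := Real.sqrt lam with hs
  have hs0 : 0 < s := Real.sqrt_pos.2 hlam
  have hsq : s ^ 2 = lam := Real.sq_sqrt hlam.le
  set g : ℝ → ℝ := fun w => s / 2 * Real.exp (-(s * |w|)) * Real.exp (t * w)
  have e1 : Set.EqOn g (fun w => s / 2 * Real.exp ((t + s) * w)) (Set.Iic 0) := by
    intro w hw
    simp only [g]
    rw [mul_assoc, ← Real.exp_add, abs_of_nonpos hw]
    ring_nf
  have e2 : Set.EqOn g (fun w => s / 2 * Real.exp ((t - s) * w)) (Set.Ioi 0) := by
    intro w hw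
    simp only [g]
    rw [mul_assoc, ← Real.exp_add, abs_of_pos hw]
    ring_nf
  have i1 : IntegrableOn g (Set.Iic 0) :=
    IntegrableOn.congr_fun ((integrableOn_exp_mul_Iic (by linarith) 0).const_mul _) e1.symm
      measurableSet_Iic
  have i2 : IntegrableOn g (Set.Ioi 0) :=
    IntegrableOn.congr_fun ((integrableOn_exp_mul_Ioi (by linarith) 0).const_mul _) e2.symm
      measurableSet_Ioi
  have hg : Integrable g := by
    rw [← integrableOn_univ, ← Set.Iic_union_Ioi (a := (0 : ℝ))]
    exact i1.union i2
  rw [← ofReal_integral_eq_lintegral_ofReal hg (ae_of_all _ fun w => by positivity),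
    ← intervalIntegral.integral_Iic_add_Ioi i1 i2, setIntegral_congr_fun measurableSet_Iic e1,
    setIntegral_congr_fun measurableSet_Ioi e2, integral_const_mul, integral_const_mul,
    integral_exp_mul_Iic (by linarith), integral_exp_mul_Ioi (by linarith)]
  congr 1
  have a1 : t + s ≠ 0 := by linarith
  have a2 : t - s ≠ 0 := by linarith
  have a3 : lam - t ^ 2 ≠ 0 := by linarith
  rw [← hsq] at a3 ⊢
  simp only [mul_zero, Real.exp_zero]
  field_simp
  ring

/-- On `w > 0` the exponents combine to `(t - √lam) w ≥ 0`, so the integrand is bounded below by a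
positive constant on a half-line. This includes the endpoint `t = √lam`. -/
theorem lintegral_laplace_mul_exp_of_sqrt_le {lam t : ℝ} (hlam : 0 < lam)
    (ht : Real.sqrt lam ≤ t) :
    ∫⁻ w : ℝ, ENNReal.ofReal
      (Real.sqrt lam / 2 * Real.exp (-(Real.sqrt lam * |w|)) * Real.exp (t * w)) = ⊤ := by
  set s := Real.sqrt lam with hs
  have hs0 : 0 < s := Real.sqrt_pos.2 hlam
  rw [eq_top_iff]
  calc (⊤ : ℝ≥0∞) = ∫⁻ _ in Set.Ioi (0 : ℝ), ENNReal.ofReal (s / 2) := by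
        rw [setLIntegral_const, Real.volume_Ioi, ENNReal.mul_top]
        simpa using hs0
    _ ≤ ∫⁻ w in Set.Ioi (0 : ℝ), ENNReal.ofReal
          (s / 2 * Real.exp (-(s * |w|)) * Real.exp (t * w)) := by
        refine setLIntegral_mono' measurableSet_Ioi fun w hw => ENNReal.ofReal_le_ofReal ?_
        rw [mul_assoc, ← Real.exp_add, abs_of_pos hw]
        refine le_mul_of_one_le_right (by positivity) (Real.one_le_exp ?_)
        have : 0 ≤ (t - s) * w := mul_nonneg (by linarith) (le_of_lt hw)
        linarith
    _ ≤ _ := setLIntegral_le_lintegral _ _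

theorem lintegral_laplace_mul_exp_of_not_lt {lam t : ℝ} (hlam : 0 < lam) (ht : ¬ t ^ 2 < lam) :
    ∫⁻ w : ℝ, ENNReal.ofReal
      (Real.sqrt lam / 2 * Real.exp (-(Real.sqrt lam * |w|)) * Real.exp (t * w)) = ⊤ := by
  rcases le_total 0 t with h | h
  · refine lintegral_laplace_mul_exp_of_sqrt_le hlam ?_
    rw [sq_lt_iff_neg_sqrt_lt_and_lt_sqrt, not_and_or] at ht
    have := Real.sqrt_pos.2 hlam
    rcases ht with ht | ht <;> linarith
  -- The reflection `w ↦ -w` replaces `t` by `-t` and preserves the prior.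
  · rw [← lintegral_laplace_mul_exp_of_sqrt_le hlam (t := -t), ← lintegral_neg_eq_self]
    · simp
    · rw [sq_lt_iff_neg_sqrt_lt_and_lt_sqrt, not_and_or] at ht
      have := Real.sqrt_pos.2 hlam
      rcases ht with ht | ht <;> linarith

/-- Tonelli's theorem, splitting off the first coordinate in the induction; the factors may have
infinite integral. -/
theorem lintegral_pi_prod_eq_prod {K : ℕ} (g : Fin K → ℝ → ℝ≥0∞) (hg : ∀ k, Measurable (g k)) :
    ∫⁻ w : Fin K → ℝ, ∏ k, g k (w k) = ∏ k, ∫⁻ x, g k x := by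
  induction K with
  | zero => simp [volume_pi]
  | succ n ih =>
    rw [Fin.prod_univ_succ, ← ih (fun k => g k.succ) fun k => hg _,
      ← lintegral_prod_mul (f := g 0) (g := fun w : Fin n → ℝ => ∏ k : Fin n, g k.succ (w k))
        (hg 0).aemeasurable
        (Finset.measurable_fun_prod _ fun k _ =>
          (hg k.succ).comp (measurable_pi_apply k)).aemeasurable,
      ← Measure.volume_eq_prod,
      ← (volume_preserving_piFinSuccAbove (fun _ => ℝ) 0).lintegral_comp]
    · simp [Fin.prod_univ_succ, Fin.tail]
    · refine ((hg 0).comp measurable_fst).mul (Finset.measurable_fun_prod _ fun k _ => ?_)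
      exact (hg _).comp ((measurable_pi_apply k).comp measurable_snd)

variable {X Y : Type*} {N K : ℕ}

theorem measurable_laplaceDensity (lam : ℝ) :
    Measurable (laplaceDensity lam : (Fin K → ℝ) → ℝ) := by
  unfold laplaceDensity
  fun_prop

theorem laplaceDensity_nonneg (lam : ℝ) (w : Fin K → ℝ) : 0 ≤ laplaceDensity lam w :=
  Finset.prod_nonneg fun k _ => by positivity

theorem lintegral_laplaceDensity_mul_exp (lam : ℝ) (θ : Fin K → ℝ) :
    ∫⁻ w : Fin K → ℝ, ENNReal.ofReal (laplaceDensity lam w * Real.exp (∑ k, θ k * w k)) =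
      ∏ k, ∫⁻ x : ℝ, ENNReal.ofReal
        (Real.sqrt lam / 2 * Real.exp (-(Real.sqrt lam * |x|)) * Real.exp (θ k * x)) := by
  rw [← lintegral_pi_prod_eq_prod _ fun k => by fun_prop]
  congr with w
  rw [Real.exp_sum, laplaceDensity, ← Finset.prod_mul_distrib, ENNReal.ofReal_prod_of_nonneg]
  intro k _
  positivity

theorem lintegral_laplaceDensity_mul_exp_of_lt {lam : ℝ} (hlam : 0 < lam) {θ : Fin K → ℝ}
    (hθ : ∀ k, θ k ^ 2 < lam) :
    ∫⁻ w : Fin K → ℝ, ENNReal.ofReal (laplaceDensity lam w * Real.exp (∑ k, θ k * w k)) =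
      ENNReal.ofReal (∏ k, (lam / (lam - θ k ^ 2))) := by
  rw [lintegral_laplaceDensity_mul_exp, ENNReal.ofReal_prod_of_nonneg]
  · exact Finset.prod_congr rfl fun k _ => lintegral_laplace_mul_exp_of_lt hlam (hθ k)
  · exact fun k _ => (div_pos hlam (sub_pos.2 (hθ k))).le

theorem lintegral_laplaceDensity_mul_exp_of_not_lt {lam : ℝ} (hlam : 0 < lam) {θ : Fin K → ℝ}
    (hθ : ¬ ∀ k, θ k ^ 2 < lam) :
    ∫⁻ w : Fin K → ℝ, ENNReal.ofReal (laplaceDensity lam w * Real.exp (∑ k, θ k * w k)) = ⊤ := by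
  rw [lintegral_laplaceDensity_mul_exp]
  push Not at hθ
  obtain ⟨k, hk⟩ := hθ
  rw [← Finset.mul_prod_erase _ _ (Finset.mem_univ k),
    lintegral_laplace_mul_exp_of_not_lt hlam (not_lt.2 hk), ENNReal.top_mul]
  -- The other factors may be finite or infinite, but none may vanish, since `⊤ * 0 = 0` in `ℝ≥0∞`.
  rw [Finset.prod_ne_zero_iff]
  intro j _
  by_cases h : θ j ^ 2 < lam
  · rw [lintegral_laplace_mul_exp_of_lt hlam h]
    simpa using div_pos hlam (sub_pos.2 h)
  · rw [lintegral_laplace_mul_exp_of_not_lt hlam h]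
    simp

/-! ### The normalization factor as an exponential moment at `η` -/

theorem margin_linearDiscriminant (T : TrainingData X Y N) (f : X → Y → Fin K → ℝ)
    (i : Fin N) (y : Y) (w : Fin K → ℝ) :
    margin T (linearDiscriminant f) i y w =
      ∑ k, (f (T.x i) (T.y i) k - f (T.x i) y k) * w k := by
  simp only [margin, linearDiscriminant, ← Finset.sum_sub_distrib]
  exact Finset.sum_congr rfl fun k _ => by ring

variable [DecidableEq Y]

theorem sum_mul_sum_eq_eta (T : TrainingData X Y N) (f : X → Y → Fin K → ℝ)
    (α : Fin N → Y → ℝ) (m : Fin K → ℝ) :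
    ∑ i, ∑ y ∈ T.rivals i, α i y *
      (∑ k, (f (T.x i) (T.y i) k - f (T.x i) y k) * m k - T.loss i y) =
      ∑ k, eta T f α k * m k - weightedLoss T α := by
  simp only [weightedLoss, mul_sub, Finset.sum_sub_distrib, Finset.mul_sum]
  congr 1
  simp_rw [Finset.sum_comm (s := T.rivals _) (t := Finset.univ)]
  rw [Finset.sum_comm]
  simp only [eta, Finset.sum_mul, mul_assoc]

theorem sum_mul_margin_sub_loss (T : TrainingData X Y N) (f : X → Y → Fin K → ℝ)
    (α : Fin N → Y → ℝ) (w : Fin K → ℝ) :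
    ∑ i, ∑ y ∈ T.rivals i, α i y * (margin T (linearDiscriminant f) i y w - T.loss i y) =
      ∑ k, eta T f α k * w k - weightedLoss T α := by
  simp only [margin_linearDiscriminant]
  exact sum_mul_sum_eq_eta T f α w

theorem unnormalizedPosterior_laplace (T : TrainingData X Y N) (f : X → Y → Fin K → ℝ)
    (lam : ℝ) (α : Fin N → Y → ℝ) (w : Fin K → ℝ) :
    unnormalizedPosterior T (linearDiscriminant f) (laplaceDensity lam) α w =
      Real.exp (-weightedLoss T α) *
        (laplaceDensity lam w * Real.exp (∑ k, eta T f α k * w k)) := by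
  rw [unnormalizedPosterior, sum_mul_margin_sub_loss, sub_eq_add_neg, Real.exp_add]
  ring

theorem normalizer_laplace (T : TrainingData X Y N) (f : X → Y → Fin K → ℝ)
    (lam : ℝ) (α : Fin N → Y → ℝ) :
    normalizer T (linearDiscriminant f) (laplaceDensity lam) α =
      ENNReal.ofReal (Real.exp (-weightedLoss T α)) *
        ∫⁻ w : Fin K → ℝ, ENNReal.ofReal
          (laplaceDensity lam w * Real.exp (∑ k, eta T f α k * w k)) := by
  simp only [normalizer, unnormalizedPosterior_laplace,
    ENNReal.ofReal_mul (Real.exp_pos (-weightedLoss T α)).le]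
  refine lintegral_const_mul _ ?_
  have := measurable_laplaceDensity (K := K) lam
  fun_prop

theorem normalizer_laplace_of_lt (T : TrainingData X Y N) (f : X → Y → Fin K → ℝ) {lam : ℝ}
    (hlam : 0 < lam) {α : Fin N → Y → ℝ} (hα : ∀ k, eta T f α k ^ 2 < lam) :
    normalizer T (linearDiscriminant f) (laplaceDensity lam) α =
      ENNReal.ofReal (Real.exp (-weightedLoss T α) * ∏ k, (lam / (lam - eta T f α k ^ 2))) := by
  rw [normalizer_laplace, lintegral_laplaceDensity_mul_exp_of_lt hlam hα,
    ENNReal.ofReal_mul (Real.exp_pos _).le]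

theorem normalizer_laplace_of_not_lt (T : TrainingData X Y N) (f : X → Y → Fin K → ℝ) {lam : ℝ}
    (hlam : 0 < lam) {α : Fin N → Y → ℝ} (hα : ¬ ∀ k, eta T f α k ^ 2 < lam) :
    normalizer T (linearDiscriminant f) (laplaceDensity lam) α = ⊤ := by
  rw [normalizer_laplace, lintegral_laplaceDensity_mul_exp_of_not_lt hlam hα, ENNReal.mul_top]
  simpa using Real.exp_pos _

end MaxEnDNet

namespace MaxEnDNet

variable {X Y : Type*} {N K : ℕ}

/-! ### Exponential tilts of the Laplace prior -/

/-- The tilt of the Laplace prior by `w ↦ θᵀ w`. -/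
noncomputable def laplaceTilt (lam : ℝ) (θ : Fin K → ℝ) : Measure (Fin K → ℝ) :=
  (prior (laplaceDensity lam)).tilted fun w => ∑ k, θ k * w k

theorem lintegral_prior_laplaceDensity_exp (lam : ℝ) (θ : Fin K → ℝ) :
    ∫⁻ w, ENNReal.ofReal (Real.exp (∑ k, θ k * w k)) ∂prior (laplaceDensity lam) =
      ∫⁻ w : Fin K → ℝ, ENNReal.ofReal (laplaceDensity lam w * Real.exp (∑ k, θ k * w k)) := by
  have := measurable_laplaceDensity (K := K) lam
  rw [prior, lintegral_withDensity_eq_lintegral_mul _ (by fun_prop) (by fun_prop)]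
  simp only [Pi.mul_apply, ENNReal.ofReal_mul (laplaceDensity_nonneg lam _)]

theorem isProbabilityMeasure_prior_laplaceDensity {lam : ℝ} (hlam : 0 < lam) :
    IsProbabilityMeasure (prior (laplaceDensity lam : (Fin K → ℝ) → ℝ)) := by
  refine ⟨?_⟩
  have h := lintegral_prior_laplaceDensity_exp (K := K) lam 0
  rw [lintegral_laplaceDensity_mul_exp_of_lt hlam (by simp [hlam])] at h
  simpa [div_self hlam.ne'] using h

theorem integrable_exp_prior_laplaceDensity {lam : ℝ} (hlam : 0 < lam) {θ : Fin K → ℝ}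
    (hθ : ∀ k, θ k ^ 2 < lam) :
    Integrable (fun w => Real.exp (∑ k, θ k * w k)) (prior (laplaceDensity lam)) := by
  refine ⟨Measurable.aestronglyMeasurable (by fun_prop), ?_⟩
  rw [hasFiniteIntegral_iff_ofReal (ae_of_all _ fun w => (Real.exp_pos _).le),
    lintegral_prior_laplaceDensity_exp, lintegral_laplaceDensity_mul_exp_of_lt hlam hθ]
  exact ENNReal.ofReal_lt_top

theorem integral_exp_prior_laplaceDensity {lam : ℝ} (hlam : 0 < lam) {θ : Fin K → ℝ}
    (hθ : ∀ k, θ k ^ 2 < lam) :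
    ∫ w, Real.exp (∑ k, θ k * w k) ∂prior (laplaceDensity lam) =
      ∏ k, (lam / (lam - θ k ^ 2)) := by
  rw [integral_eq_lintegral_of_nonneg_ae (ae_of_all _ fun w => (Real.exp_pos _).le)
    (Measurable.aestronglyMeasurable (by fun_prop)), lintegral_prior_laplaceDensity_exp,
    lintegral_laplaceDensity_mul_exp_of_lt hlam hθ, ENNReal.toReal_ofReal]
  exact Finset.prod_nonneg fun k _ => (div_pos hlam (sub_pos.2 (hθ k))).le

theorem isProbabilityMeasure_laplaceTilt {lam : ℝ} (hlam : 0 < lam) {θ : Fin K → ℝ}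
    (hθ : ∀ k, θ k ^ 2 < lam) : IsProbabilityMeasure (laplaceTilt lam θ) :=
  have := isProbabilityMeasure_prior_laplaceDensity (K := K) hlam
  isProbabilityMeasure_tilted (integrable_exp_prior_laplaceDensity hlam hθ)

/-- Tilting once more by `t w_j` only shifts the `j`-th parameter, so exponential moments of a tilt
are again moments of the prior. -/
theorem sum_mul_add_coord (θ w : Fin K → ℝ) (j : Fin K) (t : ℝ) :
    ∑ k, θ k * w k + t * w j = ∑ k, Function.update θ j (θ j + t) k * w k := by
  rw [← Finset.add_sum_erase _ _ (Finset.mem_univ j),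
    ← Finset.add_sum_erase _ (fun k => Function.update θ j (θ j + t) k * w k)
      (Finset.mem_univ j), Function.update_self,
    Finset.sum_congr rfl fun k hk => by
      rw [← Function.update_of_ne (Finset.ne_of_mem_erase hk) (θ j + t) θ]]
  ring

theorem update_sq_lt {lam : ℝ} {θ : Fin K → ℝ} (hθ : ∀ k, θ k ^ 2 < lam) {j : Fin K} {s : ℝ}
    (hs : s ^ 2 < lam) (k : Fin K) : Function.update θ j s k ^ 2 < lam := by
  rcases eq_or_ne k j with rfl | h
  · simpa using hs
  · simpa [h] using hθ k

theorem integrable_exp_mul_laplaceTilt {lam : ℝ} (hlam : 0 < lam) {θ : Fin K → ℝ}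
    (hθ : ∀ k, θ k ^ 2 < lam) {j : Fin K} {t : ℝ} (ht : (θ j + t) ^ 2 < lam) :
    Integrable (fun w : Fin K → ℝ => Real.exp (t * w j)) (laplaceTilt lam θ) := by
  rw [laplaceTilt, integrable_tilted_iff (integrable_exp_prior_laplaceDensity hlam hθ)]
  simp only [smul_eq_mul, ← Real.exp_add, sum_mul_add_coord]
  exact integrable_exp_prior_laplaceDensity hlam (update_sq_lt hθ ht)

/-- A ratio of two partition functions whose parameters differ only in coordinate `j`: all other
factors cancel. -/
theorem mgf_coord_laplaceTilt {lam : ℝ} (hlam : 0 < lam) {θ : Fin K → ℝ}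
    (hθ : ∀ k, θ k ^ 2 < lam) {j : Fin K} {t : ℝ} (ht : (θ j + t) ^ 2 < lam) :
    ProbabilityTheory.mgf (fun w : Fin K → ℝ => w j) (laplaceTilt lam θ) t =
      (lam - θ j ^ 2) / (lam - (θ j + t) ^ 2) := by
  rw [ProbabilityTheory.mgf, laplaceTilt, integral_exp_tilted]
  simp only [Pi.add_apply, sum_mul_add_coord]
  rw [integral_exp_prior_laplaceDensity hlam hθ,
    integral_exp_prior_laplaceDensity hlam (update_sq_lt hθ ht),
    ← Finset.mul_prod_erase _ _ (Finset.mem_univ j),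
    ← Finset.mul_prod_erase _ (fun k => lam / (lam - θ k ^ 2)) (Finset.mem_univ j),
    Function.update_self,
    Finset.prod_congr rfl fun k hk => by rw [Function.update_of_ne (Finset.ne_of_mem_erase hk)]]
  have hP : ∏ k ∈ Finset.univ.erase j, lam / (lam - θ k ^ 2) ≠ 0 :=
    Finset.prod_ne_zero_iff.2 fun k _ => (div_pos hlam (sub_pos.2 (hθ k))).ne'
  have h1 := (sub_pos.2 (hθ j)).ne'
  have h2 := (sub_pos.2 ht).ne'
  rw [mul_div_mul_right _ _ hP]
  field_simp

theorem eventually_add_sq_lt {lam s : ℝ} (hs : s ^ 2 < lam) :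
    ∀ᶠ t in nhds (0 : ℝ), (s + t) ^ 2 < lam := by
  have : ContinuousAt (fun t : ℝ => (s + t) ^ 2) 0 := by fun_prop
  exact this.eventually_lt continuousAt_const (by simpa using hs)

theorem zero_mem_interior_integrableExpSet_laplaceTilt {lam : ℝ} (hlam : 0 < lam)
    {θ : Fin K → ℝ} (hθ : ∀ k, θ k ^ 2 < lam) (j : Fin K) :
    (0 : ℝ) ∈ interior (ProbabilityTheory.integrableExpSet
      (fun w : Fin K → ℝ => w j) (laplaceTilt lam θ)) := by
  rw [mem_interior_iff_mem_nhds]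
  filter_upwards [eventually_add_sq_lt (hθ j)] with t ht
  exact integrable_exp_mul_laplaceTilt hlam hθ ht

theorem integrable_coord_laplaceTilt {lam : ℝ} (hlam : 0 < lam) {θ : Fin K → ℝ}
    (hθ : ∀ k, θ k ^ 2 < lam) (j : Fin K) :
    Integrable (fun w : Fin K → ℝ => w j) (laplaceTilt lam θ) := by
  have := ProbabilityTheory.integrable_pow_mul_exp_of_mem_interior_integrableExpSet
    (zero_mem_interior_integrableExpSet_laplaceTilt hlam hθ j) 1
  simpa using this

/-- The mean is the derivative at `0` of the moment generating function, whose closed form is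
available near `0`. -/
theorem integral_coord_laplaceTilt {lam : ℝ} (hlam : 0 < lam) {θ : Fin K → ℝ}
    (hθ : ∀ k, θ k ^ 2 < lam) (j : Fin K) :
    ∫ w : Fin K → ℝ, w j ∂laplaceTilt lam θ = 2 * θ j / (lam - θ j ^ 2) := by
  have h1 := (sub_pos.2 (hθ j)).ne'
  rw [← ProbabilityTheory.deriv_mgf_zero
    (zero_mem_interior_integrableExpSet_laplaceTilt hlam hθ j),
    Filter.EventuallyEq.deriv_eq (f := fun t => (lam - θ j ^ 2) / (lam - (θ j + t) ^ 2)) (by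
      filter_upwards [eventually_add_sq_lt (hθ j)] with t ht
      exact mgf_coord_laplaceTilt hlam hθ ht)]
  have hd : HasDerivAt (fun t : ℝ => lam - (θ j + t) ^ 2) (-(2 * θ j)) 0 := by
    have := (((hasDerivAt_id (0 : ℝ)).const_add (θ j)).pow 2).const_sub lam
    simpa using this
  have := (hasDerivAt_const (0 : ℝ) (lam - θ j ^ 2)).div hd (by simpa using h1)
  refine this.deriv.trans ?_
  simp only [add_zero]
  field_simp
  ring

theorem integrable_sum_mul_laplaceTilt {lam : ℝ} (hlam : 0 < lam) {θ : Fin K → ℝ}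
    (hθ : ∀ k, θ k ^ 2 < lam) (b : Fin K → ℝ) :
    Integrable (fun w : Fin K → ℝ => ∑ k, b k * w k) (laplaceTilt lam θ) :=
  integrable_finsetSum _ fun k _ => (integrable_coord_laplaceTilt hlam hθ k).const_mul _

theorem integral_sum_mul_laplaceTilt {lam : ℝ} (hlam : 0 < lam) {θ : Fin K → ℝ}
    (hθ : ∀ k, θ k ^ 2 < lam) (b : Fin K → ℝ) :
    ∫ w : Fin K → ℝ, ∑ k, b k * w k ∂laplaceTilt lam θ =
      ∑ k, b k * (2 * θ k / (lam - θ k ^ 2)) := by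
  rw [integral_finsetSum _ fun k _ => (integrable_coord_laplaceTilt hlam hθ k).const_mul _]
  simp only [integral_const_mul, integral_coord_laplaceTilt hlam hθ]

/-- The log-partition function `∑_k log (lam / (lam - θ_k²))` of the tilts of the Laplace prior. -/
noncomputable def laplaceLogPartition (lam : ℝ) (θ : Fin K → ℝ) : ℝ :=
  ∑ k, Real.log (lam / (lam - θ k ^ 2))

theorem log_integral_exp_prior_laplaceDensity {lam : ℝ} (hlam : 0 < lam) {θ : Fin K → ℝ}
    (hθ : ∀ k, θ k ^ 2 < lam) :
    Real.log (∫ w, Real.exp (∑ k, θ k * w k) ∂prior (laplaceDensity lam)) =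
      laplaceLogPartition lam θ := by
  rw [integral_exp_prior_laplaceDensity hlam hθ, Real.log_prod, laplaceLogPartition]
  exact fun k _ => (div_pos hlam (sub_pos.2 (hθ k))).ne'

/-- Gibbs' variational identity for the tilts of the Laplace prior. -/
theorem toReal_klDiv_prior_eq_add {lam : ℝ} (hlam : 0 < lam) {θ : Fin K → ℝ}
    (hθ : ∀ k, θ k ^ 2 < lam) {P : Measure (Fin K → ℝ)} [IsProbabilityMeasure P]
    (hP : klDiv P (prior (laplaceDensity lam)) ≠ ⊤)
    (hint : Integrable (fun w => ∑ k, θ k * w k) P) :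
    klDiv P (laplaceTilt lam θ) ≠ ⊤ ∧
    (klDiv P (prior (laplaceDensity lam))).toReal =
      (klDiv P (laplaceTilt lam θ)).toReal + ∫ w, ∑ k, θ k * w k ∂P -
        laplaceLogPartition lam θ := by
  have := isProbabilityMeasure_prior_laplaceDensity (K := K) hlam
  have := isProbabilityMeasure_laplaceTilt hlam hθ
  have hexp := integrable_exp_prior_laplaceDensity hlam hθ
  obtain ⟨hac, hllr⟩ := klDiv_ne_top_iff.1 hP
  have hac' : P ≪ laplaceTilt lam θ := hac.trans (absolutelyContinuous_tilted hexp)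
  refine ⟨klDiv_ne_top hac' (integrable_llr_tilted_right hac hint hllr hexp), ?_⟩
  rw [toReal_klDiv_of_measure_eq hac (by simp), toReal_klDiv_of_measure_eq hac' (by simp),
    laplaceTilt, integral_llr_tilted_right hac hint hexp hllr,
    log_integral_exp_prior_laplaceDensity hlam hθ]
  ring

/-- The log-density of the tilt is affine in `w`, hence integrable, which gives finiteness. The
value is Gibbs' identity at `P` equal to the tilt itself. -/
theorem klDiv_laplaceTilt_prior {lam : ℝ} (hlam : 0 < lam) {θ : Fin K → ℝ}
    (hθ : ∀ k, θ k ^ 2 < lam) :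
    klDiv (laplaceTilt lam θ) (prior (laplaceDensity lam)) ≠ ⊤ ∧
    (klDiv (laplaceTilt lam θ) (prior (laplaceDensity lam))).toReal =
      ∑ k, θ k * (2 * θ k / (lam - θ k ^ 2)) - laplaceLogPartition lam θ := by
  have := isProbabilityMeasure_prior_laplaceDensity (K := K) hlam
  have := isProbabilityMeasure_laplaceTilt hlam hθ
  have hexp := integrable_exp_prior_laplaceDensity hlam hθ
  have hac : laplaceTilt lam θ ≪ prior (laplaceDensity lam) := tilted_absolutelyContinuous _ _
  have hint := integrable_sum_mul_laplaceTilt hlam hθ θ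
  have hne : klDiv (laplaceTilt lam θ) (prior (laplaceDensity lam)) ≠ ⊤ := by
    refine klDiv_ne_top hac ?_
    have h := hac.ae_le (log_rnDeriv_tilted_left_self hexp)
    exact (integrable_congr h).2 (hint.sub (integrable_const _))
  refine ⟨hne, ?_⟩
  rw [(toReal_klDiv_prior_eq_add hlam hθ hne hint).2, klDiv_self,
    integral_sum_mul_laplaceTilt hlam hθ]
  simp

variable [DecidableEq Y]

/-- The losses contribute a constant factor that cancels against the normalizer, so the posterior
depends on `α` only through `η`. -/
theorem posterior_eq_laplaceTilt (T : TrainingData X Y N) (f : X → Y → Fin K → ℝ) {lam : ℝ}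
    (hlam : 0 < lam) {α : Fin N → Y → ℝ} (hα : ∀ k, eta T f α k ^ 2 < lam) :
    posterior T (linearDiscriminant f) (laplaceDensity lam) α = laplaceTilt lam (eta T f α) := by
  have := measurable_laplaceDensity (K := K) lam
  rw [posterior, laplaceTilt, Measure.tilted, prior,
    ← withDensity_mul _ (by fun_prop) (by fun_prop)]
  congr with w
  have hZ : 0 < ∏ k, (lam / (lam - eta T f α k ^ 2)) :=
    Finset.prod_pos fun k _ => div_pos hlam (sub_pos.2 (hα k))
  have hE := Real.exp_pos (-weightedLoss T α)
  rw [Pi.mul_apply, ← ENNReal.ofReal_mul (laplaceDensity_nonneg lam w),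
    normalizer_laplace_of_lt T f hlam hα, ← ENNReal.ofReal_div_of_pos (by positivity),
    unnormalizedPosterior_laplace, mul_div_mul_left _ _ hE.ne', mul_div_assoc]
  change _ = ENNReal.ofReal (_ * (_ / ∫ w, _ ∂prior (laplaceDensity lam)))
  rw [integral_exp_prior_laplaceDensity hlam hα]

end MaxEnDNet

namespace MaxEnDNet

variable {X Y : Type*} {N K : ℕ}

/-! ### Tilts with prescribed mean -/

/-- The mean equation is `u θ² + 2 θ = lam u`. Its root in the cube is `lam u / (r + 1)` with `r =
√(1 + lam u²)`, a form that also covers `u = 0`. Then `θ u = r - 1 ≤ √lam |u|`, and the partition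
function is `(1 + r) / 2`. By `klDiv_laplaceTilt_prior`, the left side of the bound is one
coordinate's share of the relative entropy. -/
theorem exists_tilt_parameter {lam : ℝ} (hlam : 0 < lam) (u : ℝ) :
    ∃ θ : ℝ, θ ^ 2 < lam ∧ 2 * θ / (lam - θ ^ 2) = u ∧
      θ * u - Real.log (lam / (lam - θ ^ 2)) ≤
        Real.sqrt lam * |u| - Real.log ((1 + Real.sqrt (1 + lam * u ^ 2)) / 2) := by
  set r := Real.sqrt (1 + lam * u ^ 2) with hr
  have hr2 : r ^ 2 = 1 + lam * u ^ 2 := Real.sq_sqrt (by positivity)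
  have hr0 : 0 ≤ r := Real.sqrt_nonneg _
  have hd : lam - (lam * u / (r + 1)) ^ 2 = 2 * lam / (r + 1) := by
    field_simp
    linear_combination hr2
  have hle : r ≤ 1 + Real.sqrt lam * |u| := by
    refine Real.sqrt_le_iff.2 ⟨by positivity, ?_⟩
    have h1 := Real.sq_sqrt hlam.le
    have h2 := sq_abs u
    have h3 : 0 ≤ Real.sqrt lam * |u| := by positivity
    nlinarith
  refine ⟨lam * u / (r + 1), ?_, ?_, ?_⟩
  · rw [← sub_pos, hd]
    positivity
  · rw [hd]
    field_simp
  · rw [hd, show lam / (2 * lam / (r + 1)) = (1 + r) / 2 by field_simp; ring,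
      show lam * u / (r + 1) * u = r - 1 by field_simp; linear_combination -hr2]
    linarith

/-- Along a ray of means `t v` the relative entropy stays below `√lam ‖t v‖₁` by any prescribed
amount. -/
theorem exists_tilt_mean_ray {lam : ℝ} (hlam : 0 < lam) {v : Fin K → ℝ} (hv : v ≠ 0) (M : ℝ) :
    ∃ t : ℝ, 0 < t ∧ ∃ θ : Fin K → ℝ, (∀ k, θ k ^ 2 < lam) ∧
      (∀ k, 2 * θ k / (lam - θ k ^ 2) = t * v k) ∧
      (klDiv (laplaceTilt lam θ) (prior (laplaceDensity lam))).toReal ≤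
        t * (Real.sqrt lam * ∑ k, |v k|) - M := by
  obtain ⟨j, hj⟩ := Function.ne_iff.1 hv
  have hj' : 0 < |v j| := abs_pos.2 hj
  have hs := Real.sqrt_pos.2 hlam
  -- Chosen so that `√lam * t * |v j| = 2 * exp M`; the logarithm of coordinate `j` alone then
  -- reaches `M`, and the others are nonnegative.
  set t : ℝ := 2 * Real.exp M / (Real.sqrt lam * |v j|) with ht
  have ht0 : 0 < t := by positivity
  choose θ h1 h2 h3 using fun k => exists_tilt_parameter hlam (t * v k)
  refine ⟨t, ht0, θ, h1, h2, ?_⟩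
  rw [(klDiv_laplaceTilt_prior hlam h1).2, laplaceLogPartition, ← Finset.sum_sub_distrib]
  simp only [h2]
  refine (Finset.sum_le_sum fun k _ => h3 k).trans ?_
  rw [Finset.sum_sub_distrib]
  have e1 : ∑ k, Real.sqrt lam * |t * v k| = t * (Real.sqrt lam * ∑ k, |v k|) := by
    simp only [abs_mul, abs_of_pos ht0, Finset.mul_sum]
    exact Finset.sum_congr rfl fun k _ => by ring
  have e2 : M ≤ Real.log ((1 + Real.sqrt (1 + lam * (t * v j) ^ 2)) / 2) := by
    rw [Real.le_log_iff_exp_le (by positivity)]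
    have : 2 * Real.exp M ≤ Real.sqrt (1 + lam * (t * v j) ^ 2) := by
      refine Real.le_sqrt_of_sq_le ?_
      have : 2 * Real.exp M = Real.sqrt lam * (t * |v j|) := by
        rw [ht]; field_simp
      rw [this, mul_pow, Real.sq_sqrt hlam.le, mul_pow, sq_abs, mul_pow]
      linarith
    linarith
  have e3 := Finset.single_le_sum
    (f := fun k => Real.log ((1 + Real.sqrt (1 + lam * (t * v k) ^ 2)) / 2))
    (fun k _ => Real.log_nonneg (by
      have : 1 ≤ Real.sqrt (1 + lam * (t * v k) ^ 2) :=
        Real.one_le_sqrt.2 (by nlinarith [mul_nonneg hlam.le (sq_nonneg (t * v k))])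
      linarith)) (Finset.mem_univ j)
  linarith

variable [DecidableEq Y]

/-! ### The pairing of multipliers with constraint values -/

/-- The pairing `∑_{i, y ≠ y_i} α_i(y) c_i(y)`. -/
def pairing (T : TrainingData X Y N) (α c : Fin N → Y → ℝ) : ℝ :=
  ∑ i, ∑ y ∈ T.rivals i, α i y * c i y

theorem pairing_add_left (T : TrainingData X Y N) (α β c : Fin N → Y → ℝ) :
    pairing T (α + β) c = pairing T α c + pairing T β c := by
  simp [pairing, add_mul, Finset.sum_add_distrib]

theorem pairing_smul_left (T : TrainingData X Y N) (t : ℝ) (α c : Fin N → Y → ℝ) :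
    pairing T (t • α) c = t * pairing T α c := by
  simp [pairing, mul_assoc, Finset.mul_sum]

theorem pairing_add_right (T : TrainingData X Y N) (α c d : Fin N → Y → ℝ) :
    pairing T α (c + d) = pairing T α c + pairing T α d := by
  simp [pairing, mul_add, Finset.sum_add_distrib]

theorem pairing_smul_right (T : TrainingData X Y N) (t : ℝ) (α c : Fin N → Y → ℝ) :
    pairing T α (t • c) = t * pairing T α c := by
  simp [pairing, mul_left_comm, Finset.mul_sum]

theorem pairing_congr_left (T : TrainingData X Y N) {α β : Fin N → Y → ℝ}
    (h : ∀ i, ∀ y ∈ T.rivals i, α i y = β i y) (c : Fin N → Y → ℝ) :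
    pairing T α c = pairing T β c :=
  Finset.sum_congr rfl fun i _ => Finset.sum_congr rfl fun y hy => by rw [h i y hy]

theorem pairing_nonneg (T : TrainingData X Y N) {α c : Fin N → Y → ℝ} (hα : MultNonneg T α)
    (hc : ∀ i, ∀ y ∈ T.rivals i, 0 ≤ c i y) : 0 ≤ pairing T α c :=
  Finset.sum_nonneg fun i _ => Finset.sum_nonneg fun y hy => mul_nonneg (hα i y hy) (hc i y hy)

theorem continuous_pairing (T : TrainingData X Y N) (c : Fin N → Y → ℝ) :
    Continuous fun α => pairing T α c := by
  unfold pairing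
  fun_prop

theorem pairing_const (T : TrainingData X Y N) (α : Fin N → Y → ℝ) (ξ : Fin N → ℝ) :
    pairing T α (fun i _ => ξ i) = ∑ i, (∑ y ∈ T.rivals i, α i y) * ξ i := by
  simp [pairing, Finset.sum_mul]

theorem eta_eq_pairing (T : TrainingData X Y N) (f : X → Y → Fin K → ℝ) (α : Fin N → Y → ℝ)
    (k : Fin K) :
    eta T f α k = pairing T α fun i y => f (T.x i) (T.y i) k - f (T.x i) y k := rfl

theorem weightedLoss_eq_pairing (T : TrainingData X Y N) (α : Fin N → Y → ℝ) :
    weightedLoss T α = pairing T α T.loss := rfl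

theorem laplaceDualObjective_eq (T : TrainingData X Y N) (f : X → Y → Fin K → ℝ) (lam : ℝ)
    (α : Fin N → Y → ℝ) :
    laplaceDualObjective T f lam α =
      weightedLoss T α - laplaceLogPartition lam (eta T f α) := rfl

/-- The expected margin excess `∫ [ΔF_i(y; w) - Δℓ_i(y)] dP(w)`. -/
noncomputable def marginExcess (T : TrainingData X Y N) (f : X → Y → Fin K → ℝ)
    (P : Measure (Fin K → ℝ)) (i : Fin N) (y : Y) : ℝ :=
  ∫ w, (margin T (linearDiscriminant f) i y w - T.loss i y) ∂P

/-! ### Expected margins and the minimization over distributions -/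

theorem sum_mul_constraintValue (T : TrainingData X Y N) (f : X → Y → Fin K → ℝ)
    (P : Measure (Fin K → ℝ)) (ξ : Fin N → ℝ) (α : Fin N → Y → ℝ) :
    ∑ i, ∑ y ∈ T.rivals i, α i y * constraintValue T (linearDiscriminant f) P ξ i y =
      pairing T α (marginExcess T f P) + pairing T α fun i _ => ξ i :=
  pairing_add_right T α (marginExcess T f P) fun i _ => ξ i

theorem integrable_sum_eta_mul {T : TrainingData X Y N} {f : X → Y → Fin K → ℝ}
    {P : Measure (Fin K → ℝ)} (hP : Admissible T (linearDiscriminant f) P)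
    (α : Fin N → Y → ℝ) :
    Integrable (fun w => ∑ k, eta T f α k * w k) P := by
  have := hP.1
  have h : (fun w : Fin K → ℝ => ∑ k, eta T f α k * w k) = fun w =>
      ∑ i, ∑ y ∈ T.rivals i, α i y * (margin T (linearDiscriminant f) i y w - T.loss i y) +
        weightedLoss T α := by
    ext w
    rw [sum_mul_margin_sub_loss]
    ring
  rw [h]
  exact (integrable_finsetSum _ fun i _ => integrable_finsetSum _ fun y hy =>
    ((hP.2 i y hy).sub (integrable_const _)).const_mul _).add (integrable_const _)

theorem pairing_marginExcess {T : TrainingData X Y N} {f : X → Y → Fin K → ℝ}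
    {P : Measure (Fin K → ℝ)} (hP : Admissible T (linearDiscriminant f) P)
    (α : Fin N → Y → ℝ) :
    pairing T α (marginExcess T f P) =
      ∫ w, ∑ k, eta T f α k * w k ∂P - weightedLoss T α := by
  have := hP.1
  have hi : ∀ i, ∀ y ∈ T.rivals i, Integrable (fun w =>
      α i y * (margin T (linearDiscriminant f) i y w - T.loss i y)) P := fun i y hy =>
    ((hP.2 i y hy).sub (integrable_const _)).const_mul _
  have h : ∫ w, ∑ k, eta T f α k * w k ∂P - weightedLoss T α =
      ∫ w, (∑ k, eta T f α k * w k - weightedLoss T α) ∂P := by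
    rw [integral_sub (integrable_sum_eta_mul hP α) (integrable_const _)]
    simp
  rw [h]
  simp only [← sum_mul_margin_sub_loss, pairing]
  rw [integral_finsetSum _ fun i _ => integrable_finsetSum _ fun y hy => hi i y hy]
  refine Finset.sum_congr rfl fun i _ => ?_
  rw [integral_finsetSum _ fun y hy => hi i y hy]
  exact Finset.sum_congr rfl fun y _ => by rw [integral_const_mul, marginExcess]

theorem admissible_laplaceTilt (T : TrainingData X Y N) (f : X → Y → Fin K → ℝ) {lam : ℝ}
    (hlam : 0 < lam) {θ : Fin K → ℝ} (hθ : ∀ k, θ k ^ 2 < lam) :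
    Admissible T (linearDiscriminant f) (laplaceTilt lam θ) := by
  refine ⟨isProbabilityMeasure_laplaceTilt hlam hθ, fun i y _ => ?_⟩
  have : margin T (linearDiscriminant f) i y = fun w =>
      ∑ k, (f (T.x i) (T.y i) k - f (T.x i) y k) * w k :=
    funext fun w => margin_linearDiscriminant T f i y w
  rw [this]
  exact integrable_sum_mul_laplaceTilt hlam hθ _

theorem pairing_marginExcess_laplaceTilt (T : TrainingData X Y N) (f : X → Y → Fin K → ℝ)
    {lam : ℝ} (hlam : 0 < lam) {θ : Fin K → ℝ} (hθ : ∀ k, θ k ^ 2 < lam)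
    (α : Fin N → Y → ℝ) :
    pairing T α (marginExcess T f (laplaceTilt lam θ)) =
      ∑ k, eta T f α k * (2 * θ k / (lam - θ k ^ 2)) - weightedLoss T α := by
  rw [pairing_marginExcess (admissible_laplaceTilt T f hlam hθ),
    integral_sum_mul_laplaceTilt hlam hθ]

/-- Gibbs' identity, with the linear term `∫ ηᵀ w dP` cancelled by the expected margins: all
dependence on `P` is left in one relative entropy. -/
theorem klDiv_sub_pairing_eq {T : TrainingData X Y N} {f : X → Y → Fin K → ℝ} {lam : ℝ}
    (hlam : 0 < lam) {P : Measure (Fin K → ℝ)} (hP : Admissible T (linearDiscriminant f) P)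
    (hkl : klDiv P (prior (laplaceDensity lam)) ≠ ⊤) {α : Fin N → Y → ℝ}
    (hα : ∀ k, eta T f α k ^ 2 < lam) :
    (klDiv P (prior (laplaceDensity lam))).toReal - pairing T α (marginExcess T f P) =
      laplaceDualObjective T f lam α + (klDiv P (laplaceTilt lam (eta T f α))).toReal := by
  have := hP.1
  rw [(toReal_klDiv_prior_eq_add hlam hα hkl (integrable_sum_eta_mul hP α)).2,
    pairing_marginExcess hP, laplaceDualObjective_eq]
  ring

theorem laplaceDualObjective_le {T : TrainingData X Y N} {f : X → Y → Fin K → ℝ} {lam : ℝ}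
    (hlam : 0 < lam) {P : Measure (Fin K → ℝ)} (hP : Admissible T (linearDiscriminant f) P)
    (hkl : klDiv P (prior (laplaceDensity lam)) ≠ ⊤) {α : Fin N → Y → ℝ}
    (hα : ∀ k, eta T f α k ^ 2 < lam) :
    laplaceDualObjective T f lam α ≤
      (klDiv P (prior (laplaceDensity lam))).toReal - pairing T α (marginExcess T f P) := by
  rw [klDiv_sub_pairing_eq hlam hP hkl hα]
  exact le_add_of_nonneg_right ENNReal.toReal_nonneg

theorem klDiv_laplaceTilt_sub_pairing (T : TrainingData X Y N) (f : X → Y → Fin K → ℝ) {lam : ℝ}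
    (hlam : 0 < lam) {α : Fin N → Y → ℝ} (hα : ∀ k, eta T f α k ^ 2 < lam) :
    (klDiv (laplaceTilt lam (eta T f α)) (prior (laplaceDensity lam))).toReal -
      pairing T α (marginExcess T f (laplaceTilt lam (eta T f α))) =
      laplaceDualObjective T f lam α := by
  have := isProbabilityMeasure_laplaceTilt hlam hα
  rw [klDiv_sub_pairing_eq hlam (admissible_laplaceTilt T f hlam hα)
    (klDiv_laplaceTilt_prior hlam hα).1 hα, klDiv_self]
  simp

/-- Since `toReal` sends `⊤` to `0`, finiteness of the entropy relative to the tilt has to be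
supplied; it is the first half of Gibbs' identity. -/
theorem eq_laplaceTilt_of_toReal_klDiv_le_zero {T : TrainingData X Y N}
    {f : X → Y → Fin K → ℝ} {lam : ℝ}
    (hlam : 0 < lam) {P : Measure (Fin K → ℝ)} (hP : Admissible T (linearDiscriminant f) P)
    (hkl : klDiv P (prior (laplaceDensity lam)) ≠ ⊤) {α : Fin N → Y → ℝ}
    (hα : ∀ k, eta T f α k ^ 2 < lam)
    (h : (klDiv P (laplaceTilt lam (eta T f α))).toReal ≤ 0) :
    P = laplaceTilt lam (eta T f α) := by
  have := hP.1
  have := isProbabilityMeasure_laplaceTilt hlam hα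
  have hne := (toReal_klDiv_prior_eq_add hlam hα hkl (integrable_sum_eta_mul hP α)).1
  rw [← klDiv_eq_zero_iff]
  exact ((ENNReal.toReal_eq_zero_iff _).1 (le_antisymm h ENNReal.toReal_nonneg)).resolve_right hne

/-! ### Real values of the primal objective and of the Lagrangian -/

theorem primalObjective_of_ne_top {p₀ : (Fin K → ℝ) → ℝ} {P : Measure (Fin K → ℝ)}
    (h : klDiv P (prior p₀) ≠ ⊤) (U : (Fin N → ℝ) → ℝ) (ξ : Fin N → ℝ) :
    primalObjective p₀ U P ξ = (((klDiv P (prior p₀)).toReal + U ξ : ℝ) : EReal) := by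
  rw [primalObjective, EReal.coe_add, EReal.coe_ennreal_toReal h]

theorem primalObjective_of_eq_top {p₀ : (Fin K → ℝ) → ℝ} {P : Measure (Fin K → ℝ)}
    (h : klDiv P (prior p₀) = ⊤) (U : (Fin N → ℝ) → ℝ) (ξ : Fin N → ℝ) :
    primalObjective p₀ U P ξ = ⊤ := by
  simp [primalObjective, h]

theorem lagrangian_of_ne_top (T : TrainingData X Y N) (f : X → Y → Fin K → ℝ)
    {p₀ : (Fin K → ℝ) → ℝ} {P : Measure (Fin K → ℝ)}
    (h : klDiv P (prior p₀) ≠ ⊤) (U : (Fin N → ℝ) → ℝ) (ξ : Fin N → ℝ) (α : Fin N → Y → ℝ) :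
    lagrangian T (linearDiscriminant f) p₀ U P ξ α =
      (((klDiv P (prior p₀)).toReal + (U ξ - (pairing T α (marginExcess T f P) +
        pairing T α fun i _ => ξ i)) : ℝ) : EReal) := by
  rw [lagrangian, sum_mul_constraintValue, EReal.coe_add, EReal.coe_ennreal_toReal h]

theorem lagrangian_of_eq_top (T : TrainingData X Y N) (f : X → Y → Fin K → ℝ)
    {p₀ : (Fin K → ℝ) → ℝ} {P : Measure (Fin K → ℝ)}
    (h : klDiv P (prior p₀) = ⊤) (U : (Fin N → ℝ) → ℝ) (ξ : Fin N → ℝ) (α : Fin N → Y → ℝ) :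
    lagrangian T (linearDiscriminant f) p₀ U P ξ α = ⊤ := by
  rw [lagrangian, h]
  exact EReal.top_add_coe _

end MaxEnDNet

namespace MaxEnDNet

variable {X Y : Type*} {N K : ℕ} [DecidableEq Y]

/-! ### Duality for a cone of slack variables -/

/-- The condition that `∑_{i, y ≠ y_i} α_i(y) ξ_i ≤ C ∑_i ξ_i` for all slack vectors `ξ ∈ S`. For a
cone `S` it describes the domain of the conjugate of the linear slack function. -/
def SlackDominated (T : TrainingData X Y N) (C : ℝ) (S : Set (Fin N → ℝ))
    (α : Fin N → Y → ℝ) : Prop :=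
  ∀ ξ ∈ S, (pairing T α fun i _ => ξ i) ≤ linearSlack C ξ

/-- The dual feasible set that belongs to a cone `S` of slack variables. -/
def dualSet (T : TrainingData X Y N) (f : X → Y → Fin K → ℝ) (lam C : ℝ)
    (S : Set (Fin N → ℝ)) : Set (Fin N → Y → ℝ) :=
  {α | MultNonneg T α ∧ SlackDominated T C S α ∧ ∀ k, eta T f α k ^ 2 < lam}

/-- The properties of a cone `S` of slack variables on which the duality rests: multipliers are
bounded, the linear program for the optimal slack variables has no duality gap, and the slack
function decreases along a feasible direction unless some multiplier vector is feasible. -/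
structure IsSlackCone (T : TrainingData X Y N) (C : ℝ) (S : Set (Fin N → ℝ)) : Prop where
  zero_mem : (0 : Fin N → ℝ) ∈ S
  smul_mem : ∀ ξ ∈ S, ∀ t : ℝ, 0 ≤ t → t • ξ ∈ S
  sum_le : ∀ α, MultNonneg T α → SlackDominated T C S α → ∀ i, ∑ y ∈ T.rivals i, α i y ≤ C
  exists_slack : ∀ α, MultNonneg T α → SlackDominated T C S α → ∀ c : Fin N → Y → ℝ,
    ∃ ξ ∈ S, (∀ i, ∀ y ∈ T.rivals i, 0 ≤ c i y + ξ i) ∧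
      ∃ β, MultNonneg T β ∧ SlackDominated T C S β ∧ pairing T β c = -linearSlack C ξ
  exists_feasible : ∀ c : Fin N → Y → ℝ, ∃ ξ ∈ S, ∀ i, ∀ y ∈ T.rivals i, 0 ≤ c i y + ξ i
  exists_descent : (¬ ∃ α, MultNonneg T α ∧ SlackDominated T C S α) →
    ∃ d : Fin N → ℝ, linearSlack C d < 0 ∧ (∀ ξ ∈ S, ξ + d ∈ S) ∧
      ∀ i, ∀ y ∈ T.rivals i, 0 ≤ d i

/-! ### The conjugate of the linear slack function and the value of the dual objective -/

theorem linearSlack_add (C : ℝ) (ξ ζ : Fin N → ℝ) :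
    linearSlack C (ξ + ζ) = linearSlack C ξ + linearSlack C ζ := by
  simp [linearSlack, Finset.sum_add_distrib, mul_add]

theorem linearSlack_smul (C t : ℝ) (ξ : Fin N → ℝ) :
    linearSlack C (t • ξ) = t * linearSlack C ξ := by
  simp [linearSlack, ← Finset.mul_sum, mul_left_comm]

theorem linearSlack_zero (C : ℝ) : linearSlack C (0 : Fin N → ℝ) = 0 := by simp [linearSlack]

theorem pairing_const_zero (T : TrainingData X Y N) (α : Fin N → Y → ℝ) :
    (pairing T α fun i _ => (0 : Fin N → ℝ) i) = 0 := by simp [pairing]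

theorem eta_combination (T : TrainingData X Y N) (f : X → Y → Fin K → ℝ)
    (α β : Fin N → Y → ℝ) (a b : ℝ) (k : Fin K) :
    eta T f (a • α + b • β) k = a * eta T f α k + b * eta T f β k := by
  simp only [eta_eq_pairing, pairing_add_left, pairing_smul_left]

theorem MultNonneg.combination {T : TrainingData X Y N} {α β : Fin N → Y → ℝ}
    (hα : MultNonneg T α) (hβ : MultNonneg T β) {a b : ℝ} (ha : 0 ≤ a) (hb : 0 ≤ b) :
    MultNonneg T (a • α + b • β) := fun i y hy =>
  add_nonneg (mul_nonneg ha (hα i y hy)) (mul_nonneg hb (hβ i y hy))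

theorem SlackDominated.combination {T : TrainingData X Y N} {C : ℝ} {S : Set (Fin N → ℝ)}
    {α β : Fin N → Y → ℝ} (hα : SlackDominated T C S α) (hβ : SlackDominated T C S β)
    {a b : ℝ} (ha : 0 ≤ a) (hb : 0 ≤ b) (hab : a + b = 1) :
    SlackDominated T C S (a • α + b • β) := by
  intro ξ hξ
  rw [pairing_add_left, pairing_smul_left, pairing_smul_left]
  have h1 := mul_le_mul_of_nonneg_left (hα ξ hξ) ha
  have h2 := mul_le_mul_of_nonneg_left (hβ ξ hξ) hb
  calc _ ≤ (a + b) * linearSlack C ξ := by linarith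
    _ = _ := by rw [hab, one_mul]

theorem slackConjugate_of_slackDominated {T : TrainingData X Y N} {C : ℝ}
    {S : Set (Fin N → ℝ)} (hS : (0 : Fin N → ℝ) ∈ S) {α : Fin N → Y → ℝ}
    (h : SlackDominated T C S α) : slackConjugate T (linearSlack C) S α = 0 := by
  refine le_antisymm (iSup₂_le fun ξ hξ => ?_) ?_
  · exact_mod_cast sub_nonpos.2 (h ξ hξ)
  · refine le_iSup₂_of_le 0 hS ?_
    simp [linearSlack]

/-- A slack vector violating the inequality can be scaled up inside the cone, which makes the
supremum infinite. -/
theorem slackConjugate_of_not_slackDominated {T : TrainingData X Y N} {C : ℝ}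
    {S : Set (Fin N → ℝ)} (hS : ∀ ξ ∈ S, ∀ t : ℝ, 0 ≤ t → t • ξ ∈ S) {α : Fin N → Y → ℝ}
    (h : ¬ SlackDominated T C S α) : slackConjugate T (linearSlack C) S α = ⊤ := by
  simp only [SlackDominated, not_forall, not_le] at h
  obtain ⟨ξ, hξ, hlt⟩ := h
  rw [EReal.eq_top_iff_forall_lt]
  intro M
  set q := (pairing T α fun i _ => ξ i) - linearSlack C ξ with hq
  have hq0 : 0 < q := sub_pos.2 hlt
  obtain ⟨t, ht, htq⟩ : ∃ t : ℝ, 0 ≤ t ∧ t * q = |M| + 1 :=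
    ⟨(|M| + 1) / q, by positivity, div_mul_cancel₀ _ hq0.ne'⟩
  have e1 : (pairing T α fun i _ => (t • ξ) i) = t * pairing T α fun i _ => ξ i :=
    pairing_smul_right T t α fun i _ => ξ i
  have e2 : (pairing T α fun i _ => (t • ξ) i) - linearSlack C (t • ξ) = |M| + 1 := by
    rw [e1, linearSlack_smul, ← mul_sub, htq]
  calc (M : EReal) < ((|M| + 1 : ℝ) : EReal) := by
        exact_mod_cast (le_abs_self M).trans_lt (lt_add_one _)
    _ = (((pairing T α fun i _ => (t • ξ) i) - linearSlack C (t • ξ) : ℝ) : EReal) := by rw [e2]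
    _ ≤ slackConjugate T (linearSlack C) S α := le_iSup₂_of_le (t • ξ) (hS ξ hξ t ht) le_rfl

theorem dualObjective_of_mem_dualSet {T : TrainingData X Y N} {f : X → Y → Fin K → ℝ}
    {lam C : ℝ} (hlam : 0 < lam) {S : Set (Fin N → ℝ)} (hS : (0 : Fin N → ℝ) ∈ S)
    {α : Fin N → Y → ℝ} (hα : α ∈ dualSet T f lam C S) :
    dualObjective T (linearDiscriminant f) (laplaceDensity lam) (linearSlack C) S α =
      (laplaceDualObjective T f lam α : EReal) := by
  have hpos : ∀ k ∈ Finset.univ, lam / (lam - eta T f α k ^ 2) ≠ 0 := fun k _ =>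
    (div_pos hlam (sub_pos.2 (hα.2.2 k))).ne'
  have hprod : 0 < ∏ k, (lam / (lam - eta T f α k ^ 2)) :=
    Finset.prod_pos fun k _ => div_pos hlam (sub_pos.2 (hα.2.2 k))
  rw [dualObjective, slackConjugate_of_slackDominated hS hα.2.1,
    normalizer_laplace_of_lt T f hlam hα.2.2,
    ENNReal.log_ofReal_of_pos (mul_pos (Real.exp_pos _) hprod),
    Real.log_mul (Real.exp_pos _).ne' hprod.ne', Real.log_exp, Real.log_prod hpos, sub_zero,
    laplaceDualObjective, ← EReal.coe_neg]
  congr 1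
  ring

theorem dualObjective_of_notMem_dualSet {T : TrainingData X Y N} {f : X → Y → Fin K → ℝ}
    {lam C : ℝ} (hlam : 0 < lam) {S : Set (Fin N → ℝ)} (hS : IsSlackCone T C S)
    {α : Fin N → Y → ℝ} (hα : MultNonneg T α) (h : α ∉ dualSet T f lam C S) :
    dualObjective T (linearDiscriminant f) (laplaceDensity lam) (linearSlack C) S α = ⊥ := by
  -- As a sum, `⊥` absorbs the other term even if that is `⊤`, so one infinite part suffices.
  rw [dualObjective, sub_eq_add_neg]
  by_cases hbox : ∀ k, eta T f α k ^ 2 < lam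
  · have hdom : ¬ SlackDominated T C S α := fun hd => h ⟨hα, hd, hbox⟩
    rw [slackConjugate_of_not_slackDominated hS.smul_mem hdom]
    simp
  · rw [normalizer_laplace_of_not_lt T f hlam hbox]
    simp

/-- The value `⊥` has to be excluded at a solution: if `dualSet` is empty, every nonnegative vector
maximizes the general objective. -/
theorem isDualSolution_iff {T : TrainingData X Y N} {f : X → Y → Fin K → ℝ}
    {lam C : ℝ} (hlam : 0 < lam) {S : Set (Fin N → ℝ)} (hS : IsSlackCone T C S)
    (α : Fin N → Y → ℝ) :
    IsDualSolution T (linearDiscriminant f) (laplaceDensity lam) (linearSlack C) S α ↔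
      SolvesLaplaceDual T f lam (dualSet T f lam C S) α := by
  constructor
  · rintro ⟨hα, hne, hmax⟩
    have hmem : α ∈ dualSet T f lam C S := by
      by_contra h
      exact hne (dualObjective_of_notMem_dualSet hlam hS hα h)
    refine ⟨hmem, fun β hβ => ?_⟩
    have := hmax β hβ.1
    rw [dualObjective_of_mem_dualSet hlam hS.zero_mem hmem,
      dualObjective_of_mem_dualSet hlam hS.zero_mem hβ] at this
    exact_mod_cast this
  · rintro ⟨hmem, hmax⟩
    refine ⟨hmem.1, ?_, fun β hβ => ?_⟩
    · rw [dualObjective_of_mem_dualSet hlam hS.zero_mem hmem]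
      exact EReal.coe_ne_bot _
    · by_cases h : β ∈ dualSet T f lam C S
      · rw [dualObjective_of_mem_dualSet hlam hS.zero_mem hmem,
          dualObjective_of_mem_dualSet hlam hS.zero_mem h]
        exact_mod_cast hmax h
      · rw [dualObjective_of_notMem_dualSet hlam hS hβ h]
        exact bot_le

/-! ### Saddle points solve the dual problem -/

/-- The tilt with parameter `0`, which is the prior, is a competitor with finite Lagrangian. -/
theorem IsSaddlePoint.klDiv_ne_top {T : TrainingData X Y N} {f : X → Y → Fin K → ℝ}
    {lam : ℝ} (hlam : 0 < lam) {U : (Fin N → ℝ) → ℝ} {S : Set (Fin N → ℝ)}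
    {P : Measure (Fin K → ℝ)} {ξ : Fin N → ℝ} {α : Fin N → Y → ℝ}
    (h : IsSaddlePoint T (linearDiscriminant f) (laplaceDensity lam) U S P ξ α) :
    klDiv P (prior (laplaceDensity lam)) ≠ ⊤ := by
  intro htop
  have h0 : ∀ k : Fin K, (0 : Fin K → ℝ) k ^ 2 < lam := fun _ => by simpa using hlam
  have := h.2.2.2.2 (laplaceTilt lam 0) ξ (admissible_laplaceTilt T f hlam h0) h.2.1
  rw [lagrangian_of_eq_top T f htop, lagrangian_of_ne_top T f (klDiv_laplaceTilt_prior hlam h0).1,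
    top_le_iff] at this
  exact EReal.coe_ne_top _ this

/-- A multiplier vector for which the Lagrangian is bounded below satisfies `η_k² < lam`. -/
theorem eta_sq_lt_of_forall_le {T : TrainingData X Y N} {f : X → Y → Fin K → ℝ}
    {lam : ℝ} (hlam : 0 < lam) {α : Fin N → Y → ℝ} {B : ℝ}
    (h : ∀ θ : Fin K → ℝ, (∀ k, θ k ^ 2 < lam) →
      B ≤ (klDiv (laplaceTilt lam θ) (prior (laplaceDensity lam))).toReal -
        pairing T α (marginExcess T f (laplaceTilt lam θ))) (k : Fin K) :
    eta T f α k ^ 2 < lam := by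
  by_contra hk
  rw [not_lt] at hk
  set e := eta T f α k with he
  have habs : Real.sqrt lam ≤ |e| := Real.sqrt_le_iff.2 ⟨abs_nonneg _, by rwa [sq_abs]⟩
  have he0 : e ≠ 0 := abs_pos.1 ((Real.sqrt_pos.2 hlam).trans_le habs)
  -- Means `t e` in coordinate `k` alone gain `t e²` from the pairing, at least the linear entropy
  -- cost `t √lam |e|`. The logarithmic amount is set so that the value falls to `B - 1`.
  have hv : (Pi.single k e : Fin K → ℝ) ≠ 0 := by simpa using he0
  obtain ⟨t, ht, θ, hθ, hmean, hkl⟩ :=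
    exists_tilt_mean_ray hlam hv (weightedLoss T α - B + 1)
  have hB := h θ hθ
  rw [pairing_marginExcess_laplaceTilt T f hlam hθ] at hB
  simp only [hmean] at hB
  have e1 : ∑ j, |(Pi.single k e : Fin K → ℝ) j| = |e| := by
    rw [Finset.sum_eq_single k]
    · simp
    · intro j _ hj
      simp [hj]
    · simp
  have e2 : ∑ j, eta T f α j * (t * (Pi.single k e : Fin K → ℝ) j) = t * (|e| * |e|) := by
    rw [Finset.sum_eq_single k]
    · rw [Pi.single_eq_same, abs_mul_abs_self, ← he]
      ring
    · intro j _ hj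
      simp [hj]
    · simp
  rw [e1] at hkl
  rw [e2] at hB
  have := mul_le_mul_of_nonneg_left (mul_le_mul_of_nonneg_right habs (abs_nonneg e)) ht.le
  linarith

theorem nonneg_of_forall_le_mul {a q : ℝ} (h : ∀ t : ℝ, 0 ≤ t → a ≤ t * q) : 0 ≤ q := by
  by_contra hq
  rw [not_le] at hq
  have h1 := h ((|a| + 1) / -q) (div_nonneg (by positivity) (by linarith))
  have h2 : (|a| + 1) / -q * q = -(|a| + 1) := by
    rw [div_neg, neg_mul, div_mul_cancel₀ _ hq.ne]
  have := neg_abs_le a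
  linarith

theorem IsSaddlePoint.solvesLaplaceDual {T : TrainingData X Y N} {f : X → Y → Fin K → ℝ}
    {lam C : ℝ} (hlam : 0 < lam) {S : Set (Fin N → ℝ)} (hS : IsSlackCone T C S)
    {P : Measure (Fin K → ℝ)} {ξ : Fin N → ℝ} {α : Fin N → Y → ℝ}
    (h : IsSaddlePoint T (linearDiscriminant f) (laplaceDensity lam) (linearSlack C) S P ξ α) :
    SolvesLaplaceDual T f lam (dualSet T f lam C S) α := by
  have hkl := h.klDiv_ne_top hlam
  obtain ⟨hP, hξ, hα, hmaxE, hminE⟩ := h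
  have hmax : ∀ β, MultNonneg T β →
      pairing T α (marginExcess T f P) + (pairing T α fun i _ => ξ i) ≤
        pairing T β (marginExcess T f P) + pairing T β fun i _ => ξ i := by
    intro β hβ
    have := hmaxE β hβ
    rw [lagrangian_of_ne_top T f hkl, lagrangian_of_ne_top T f hkl, EReal.coe_le_coe_iff] at this
    linarith
  have hmin : ∀ P' ξ', Admissible T (linearDiscriminant f) P' →
      klDiv P' (prior (laplaceDensity lam)) ≠ ⊤ → ξ' ∈ S →
      (klDiv P (prior (laplaceDensity lam))).toReal - pairing T α (marginExcess T f P) +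
        (linearSlack C ξ - pairing T α fun i _ => ξ i) ≤
      (klDiv P' (prior (laplaceDensity lam))).toReal - pairing T α (marginExcess T f P') +
        (linearSlack C ξ' - pairing T α fun i _ => ξ' i) := by
    intro P' ξ' hP' hkl' hξ'
    have := hminE P' ξ' hP' hξ'
    rw [lagrangian_of_ne_top T f hkl, lagrangian_of_ne_top T f hkl', EReal.coe_le_coe_iff] at this
    linarith
  have hdom : SlackDominated T C S α := by
    intro ζ hζ
    -- Minimality of the Lagrangian along the ray `t • ζ` bounds a linear function of `t` from
    -- below, so its slope is nonnegative.
    rw [← sub_nonneg]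
    refine nonneg_of_forall_le_mul
      (a := linearSlack C ξ - pairing T α fun i _ => ξ i) fun t ht => ?_
    have h1 := hmin P (t • ζ) hP hkl (hS.smul_mem ζ hζ t ht)
    have h2 : (pairing T α fun i _ => (t • ζ) i) = t * pairing T α fun i _ => ζ i :=
      pairing_smul_right T t α fun i _ => ζ i
    rw [linearSlack_smul, h2] at h1
    linarith
  have hξ0 : linearSlack C ξ - (pairing T α fun i _ => ξ i) ≤ 0 := by
    have := hmin P 0 hP hkl hS.zero_mem
    rw [linearSlack_zero, pairing_const_zero] at this
    linarith
  have hξ1 := hdom ξ hξ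
  have hbox : ∀ k, eta T f α k ^ 2 < lam := by
    refine eta_sq_lt_of_forall_le hlam (B := (klDiv P (prior (laplaceDensity lam))).toReal -
      pairing T α (marginExcess T f P)) fun θ hθ => ?_
    have := hmin _ ξ (admissible_laplaceTilt T f hlam hθ) (klDiv_laplaceTilt_prior hlam hθ).1 hξ
    linarith
  refine ⟨⟨hα, hdom, hbox⟩, fun β hβ => ?_⟩
  -- The chain is: dual value at `β` ≤ Lagrangian at `(P, ξ, β)` ≤ Lagrangian at `(P, ξ, α)` ≤
  -- Lagrangian at `(tilt, 0, α)` = dual value at `α`.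
  have h1 := laplaceDualObjective_le hlam hP hkl hβ.2.2
  have h2 := hmax β hβ.1
  have h3 := hβ.2.1 ξ hξ
  have h4 := hmin _ 0 (admissible_laplaceTilt T f hlam hbox)
    (klDiv_laplaceTilt_prior hlam hbox).1 hS.zero_mem
  rw [klDiv_laplaceTilt_sub_pairing T f hlam hbox, linearSlack_zero, pairing_const_zero] at h4
  change laplaceDualObjective T f lam β ≤ laplaceDualObjective T f lam α
  linarith

/-! ### Solutions of the dual problem yield saddle points and primal solutions -/

theorem hasDerivAt_line_zero (a b : ℝ) :
    HasDerivAt (fun t : ℝ => (1 - t) * a + t * b) (b - a) 0 := by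
  have h : (fun t : ℝ => (1 - t) * a + t * b) = fun t => a + t * (b - a) := by
    ext t
    ring
  rw [h]
  simpa using ((hasDerivAt_id (0 : ℝ)).mul_const (b - a)).const_add a

theorem hasDerivAt_log_div_sub_sq {lam s : ℝ} (hs : s ^ 2 < lam) :
    HasDerivAt (fun x : ℝ => Real.log (lam / (lam - x ^ 2))) (2 * s / (lam - s ^ 2)) s := by
  have hlam : lam ≠ 0 := ((sq_nonneg s).trans_lt hs).ne'
  have h1 := (sub_pos.2 hs).ne'
  have d : HasDerivAt (fun x : ℝ => lam - x ^ 2) (-(2 * s)) s := by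
    simpa using (hasDerivAt_pow 2 s).const_sub lam
  have := ((hasDerivAt_const s lam).fun_div d h1).log (div_ne_zero hlam h1)
  convert this using 1
  field_simp
  ring

/-- The derivative of the log-partition function is the mean of the tilt, so the gradient of the
dual objective at `α` is minus the expected margin excess of the tilt. -/
theorem hasDerivAt_laplaceDualObjective_line (T : TrainingData X Y N) (f : X → Y → Fin K → ℝ)
    {lam : ℝ} (hlam : 0 < lam) {α : Fin N → Y → ℝ} (hα : ∀ k, eta T f α k ^ 2 < lam)
    (β : Fin N → Y → ℝ) :
    HasDerivAt (fun t : ℝ => laplaceDualObjective T f lam ((1 - t) • α + t • β))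
      (pairing T α (marginExcess T f (laplaceTilt lam (eta T f α))) -
        pairing T β (marginExcess T f (laplaceTilt lam (eta T f α)))) 0 := by
  simp only [pairing_marginExcess_laplaceTilt T f hlam hα, laplaceDualObjective,
    weightedLoss_eq_pairing, pairing_add_left, pairing_smul_left, eta_combination]
  have h : ∀ k ∈ Finset.univ, HasDerivAt
      (fun t : ℝ => Real.log (lam / (lam - ((1 - t) * eta T f α k + t * eta T f β k) ^ 2)))
      (2 * eta T f α k / (lam - eta T f α k ^ 2) * (eta T f β k - eta T f α k)) 0 := by
    intro k _
    have d : HasDerivAt (fun x : ℝ => Real.log (lam / (lam - x ^ 2)))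
        (2 * eta T f α k / (lam - eta T f α k ^ 2))
        ((1 - 0) * eta T f α k + 0 * eta T f β k) := by
      simpa using hasDerivAt_log_div_sub_sq (hα k)
    exact d.comp (0 : ℝ) (hasDerivAt_line_zero _ _)
  refine ((hasDerivAt_line_zero (pairing T α T.loss) (pairing T β T.loss)).fun_sub
    (HasDerivAt.fun_sum h)).congr_deriv ?_
  have e : ∀ k, 2 * eta T f α k / (lam - eta T f α k ^ 2) * (eta T f β k - eta T f α k) =
      eta T f β k * (2 * eta T f α k / (lam - eta T f α k ^ 2)) -
        eta T f α k * (2 * eta T f α k / (lam - eta T f α k ^ 2)) := fun k => by ring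
  simp only [e, Finset.sum_sub_distrib]
  ring

/-- First-order optimality. `β` itself need not satisfy `η_k² < lam`: the cube is open, so a short
initial segment from `α` towards `β` is feasible. -/
theorem pairing_marginExcess_le_of_solves {T : TrainingData X Y N} {f : X → Y → Fin K → ℝ}
    {lam C : ℝ} (hlam : 0 < lam) {S : Set (Fin N → ℝ)} {α β : Fin N → Y → ℝ}
    (hα : SolvesLaplaceDual T f lam (dualSet T f lam C S) α)
    (hβ : MultNonneg T β) (hβS : SlackDominated T C S β) :
    pairing T α (marginExcess T f (laplaceTilt lam (eta T f α))) ≤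
      pairing T β (marginExcess T f (laplaceTilt lam (eta T f α))) := by
  obtain ⟨⟨hα0, hαS, hbox⟩, hmax⟩ := hα
  have hd := (hasDerivAt_laplaceDualObjective_line T f hlam hbox β).hasDerivWithinAt
    (s := Set.Ioi 0)
  rw [hasDerivWithinAt_iff_tendsto_slope' (by simp)] at hd
  rw [← sub_nonpos]
  refine le_of_tendsto hd ?_
  have hev : ∀ᶠ t in nhds (0 : ℝ), ∀ k, eta T f ((1 - t) • α + t • β) k ^ 2 < lam := by
    rw [Filter.eventually_all]
    intro k
    simp only [eta_combination]
    have : ContinuousAt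
        (fun t : ℝ => ((1 - t) * eta T f α k + t * eta T f β k) ^ 2) 0 := by fun_prop
    exact this.eventually_lt continuousAt_const (by simpa using hbox k)
  filter_upwards [nhdsWithin_le_nhds hev, Ioo_mem_nhdsGT (zero_lt_one' ℝ)] with t ht ht1
  have hmem : (1 - t) • α + t • β ∈ dualSet T f lam C S :=
    ⟨hα0.combination hβ (by linarith [ht1.2]) ht1.1.le,
      hαS.combination hβS (by linarith [ht1.2]) ht1.1.le (by ring), ht⟩
  have hle : laplaceDualObjective T f lam ((1 - t) • α + t • β) ≤
      laplaceDualObjective T f lam α := hmax hmem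
  rw [slope_def_field]
  refine div_nonpos_of_nonpos_of_nonneg ?_ (by linarith [ht1.1])
  simpa using hle

/-- Complementary slackness at a solution of the dual problem. -/
theorem exists_complementary_slack {T : TrainingData X Y N} {f : X → Y → Fin K → ℝ}
    {lam C : ℝ} (hlam : 0 < lam) {S : Set (Fin N → ℝ)} (hS : IsSlackCone T C S)
    {α : Fin N → Y → ℝ} (hα : SolvesLaplaceDual T f lam (dualSet T f lam C S) α) :
    ∃ ξ ∈ S,
      (∀ i, ∀ y ∈ T.rivals i, 0 ≤ marginExcess T f (laplaceTilt lam (eta T f α)) i y + ξ i) ∧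
      (pairing T α fun i _ => ξ i) = linearSlack C ξ ∧
      pairing T α (marginExcess T f (laplaceTilt lam (eta T f α))) = -linearSlack C ξ := by
  obtain ⟨ξ, hξ, hc, β, hβ, hβS, heq⟩ := hS.exists_slack α hα.1.1 hα.1.2.1
    (marginExcess T f (laplaceTilt lam (eta T f α)))
  -- With `c` the margin excess, `⟨α, c⟩ ≤ ⟨β, c⟩ = -U(ξ) ≤ -⟨α, ξ⟩ ≤ ⟨α, c⟩`, so equality holds
  -- throughout.
  have h1 := pairing_marginExcess_le_of_solves hlam hα hβ hβS
  have h2 := hα.1.2.1 ξ hξ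
  have h3 := pairing_nonneg T hα.1.1
    (c := marginExcess T f (laplaceTilt lam (eta T f α)) + fun i _ => ξ i) hc
  rw [pairing_add_right] at h3
  exact ⟨ξ, hξ, hc, by linarith, by linarith⟩

theorem isLagrangeMultiplier_of_solves {T : TrainingData X Y N} {f : X → Y → Fin K → ℝ}
    {lam C : ℝ} (hlam : 0 < lam) {S : Set (Fin N → ℝ)} (hS : IsSlackCone T C S)
    {α : Fin N → Y → ℝ} (hα : SolvesLaplaceDual T f lam (dualSet T f lam C S) α) :
    IsLagrangeMultiplier T (linearDiscriminant f) (laplaceDensity lam) (linearSlack C) S α := by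
  obtain ⟨ξ, hξ, hc, h1, h2⟩ := exists_complementary_slack hlam hS hα
  have hbox := hα.1.2.2
  have hkl := (klDiv_laplaceTilt_prior hlam hbox).1
  refine ⟨laplaceTilt lam (eta T f α), ξ, admissible_laplaceTilt T f hlam hbox, hξ, hα.1.1,
    fun β hβ => ?_, fun P' ξ' hP' hξ' => ?_⟩
  -- Complementary slackness makes the penalty of `α` zero; that of `β` is a nonnegative amount that
  -- is subtracted.
  · rw [lagrangian_of_ne_top T f hkl, lagrangian_of_ne_top T f hkl, EReal.coe_le_coe_iff]
    have := pairing_nonneg T hβ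
      (c := marginExcess T f (laplaceTilt lam (eta T f α)) + fun i _ => ξ i) hc
    rw [pairing_add_right] at this
    linarith
  · by_cases hkl' : klDiv P' (prior (laplaceDensity lam)) = ⊤
    · rw [lagrangian_of_eq_top T f hkl']
      exact le_top
    · rw [lagrangian_of_ne_top T f hkl, lagrangian_of_ne_top T f hkl', EReal.coe_le_coe_iff]
      have h3 := laplaceDualObjective_le hlam hP' hkl' hbox
      have h4 := klDiv_laplaceTilt_sub_pairing T f hlam hbox
      have h5 := hα.1.2.1 ξ' hξ'
      linarith

theorem isLagrangeMultiplier_iff {T : TrainingData X Y N} {f : X → Y → Fin K → ℝ}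
    {lam C : ℝ} (hlam : 0 < lam) {S : Set (Fin N → ℝ)} (hS : IsSlackCone T C S)
    (α : Fin N → Y → ℝ) :
    IsLagrangeMultiplier T (linearDiscriminant f) (laplaceDensity lam) (linearSlack C) S α ↔
      SolvesLaplaceDual T f lam (dualSet T f lam C S) α :=
  ⟨fun ⟨_, _, h⟩ => h.solvesLaplaceDual hlam hS, isLagrangeMultiplier_of_solves hlam hS⟩

/-- Weak duality with remainder: the primal value at a feasible point exceeds the dual value by at
least the relative entropy to the tilted prior. -/
theorem laplaceDualObjective_add_klDiv_le {T : TrainingData X Y N} {f : X → Y → Fin K → ℝ}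
    {lam C : ℝ} (hlam : 0 < lam) {S : Set (Fin N → ℝ)} {α : Fin N → Y → ℝ}
    (hα : α ∈ dualSet T f lam C S) {P : Measure (Fin K → ℝ)} {ξ : Fin N → ℝ}
    (hP : PrimalFeasible T (linearDiscriminant f) S P ξ)
    (hkl : klDiv P (prior (laplaceDensity lam)) ≠ ⊤) :
    laplaceDualObjective T f lam α + (klDiv P (laplaceTilt lam (eta T f α))).toReal ≤
      (klDiv P (prior (laplaceDensity lam))).toReal + linearSlack C ξ := by
  rw [← klDiv_sub_pairing_eq hlam hP.1 hkl hα.2.2]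
  have h1 := pairing_nonneg T hα.1 (c := marginExcess T f P + fun i _ => ξ i) hP.2.2
  rw [pairing_add_right] at h1
  have h2 := hα.2.1 ξ hP.2.1
  linarith

/-- With the complementary slack vector, the tilt attains the dual value. At any other solution the
entropy remainder in weak duality must then vanish. -/
theorem primal_of_solves {T : TrainingData X Y N} {f : X → Y → Fin K → ℝ}
    {lam C : ℝ} (hlam : 0 < lam) {S : Set (Fin N → ℝ)} (hS : IsSlackCone T C S)
    {α : Fin N → Y → ℝ} (hα : SolvesLaplaceDual T f lam (dualSet T f lam C S) α) :
    (∃ ξ, IsPrimalSolution T (linearDiscriminant f) (laplaceDensity lam) (linearSlack C) S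
      (posterior T (linearDiscriminant f) (laplaceDensity lam) α) ξ) ∧
    ∀ P ξ, IsPrimalSolution T (linearDiscriminant f) (laplaceDensity lam) (linearSlack C) S P ξ →
      P = posterior T (linearDiscriminant f) (laplaceDensity lam) α := by
  obtain ⟨ξ, hξ, hc, h1, h2⟩ := exists_complementary_slack hlam hS hα
  have hbox := hα.1.2.2
  have hkl := (klDiv_laplaceTilt_prior hlam hbox).1
  have hval := klDiv_laplaceTilt_sub_pairing T f hlam hbox
  have hfeas : PrimalFeasible T (linearDiscriminant f) S (laplaceTilt lam (eta T f α)) ξ :=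
    ⟨admissible_laplaceTilt T f hlam hbox, hξ, hc⟩
  rw [posterior_eq_laplaceTilt T f hlam hbox]
  refine ⟨⟨ξ, hfeas, fun P' ξ' hP' => ?_⟩, fun P ζ hP => ?_⟩
  · by_cases hkl' : klDiv P' (prior (laplaceDensity lam)) = ⊤
    · rw [primalObjective_of_eq_top hkl']
      exact le_top
    · rw [primalObjective_of_ne_top hkl, primalObjective_of_ne_top hkl', EReal.coe_le_coe_iff]
      have h3 := laplaceDualObjective_add_klDiv_le hlam hα.1 hP' hkl'
      have h4 : 0 ≤ (klDiv P' (laplaceTilt lam (eta T f α))).toReal := ENNReal.toReal_nonneg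
      linarith
  · have hle := hP.2 _ _ hfeas
    rw [primalObjective_of_ne_top hkl] at hle
    have hkl' : klDiv P (prior (laplaceDensity lam)) ≠ ⊤ := by
      intro htop
      rw [primalObjective_of_eq_top htop, top_le_iff] at hle
      exact EReal.coe_ne_top _ hle
    rw [primalObjective_of_ne_top hkl', EReal.coe_le_coe_iff] at hle
    refine eq_laplaceTilt_of_toReal_klDiv_le_zero hlam hP.1.1 hkl' hbox ?_
    have h3 := laplaceDualObjective_add_klDiv_le hlam hα.1 hP.1 hkl'
    linarith

end MaxEnDNet

namespace MaxEnDNet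

variable {X Y : Type*} {N K : ℕ} [DecidableEq Y]

/-! ### Existence of solutions of the dual problem -/

/-- The right-hand side is continuous everywhere and vanishes where some `η_k² = lam`, so
compactness can be applied on the closed cube. -/
theorem exp_laplaceDualObjective (T : TrainingData X Y N) (f : X → Y → Fin K → ℝ)
    {lam : ℝ} (hlam : 0 < lam) {α : Fin N → Y → ℝ} (hα : ∀ k, eta T f α k ^ 2 < lam) :
    Real.exp (laplaceDualObjective T f lam α) =
      Real.exp (weightedLoss T α) * ∏ k, ((lam - eta T f α k ^ 2) / lam) := by
  rw [laplaceDualObjective, Real.exp_sub, Real.exp_sum, div_eq_mul_inv, ← Finset.prod_inv_distrib]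
  congr 1
  refine Finset.prod_congr rfl fun k _ => ?_
  rw [Real.exp_log (div_pos hlam (sub_pos.2 (hα k))), inv_div]

theorem le_of_slackCone {T : TrainingData X Y N} {C : ℝ} {S : Set (Fin N → ℝ)}
    (hS : IsSlackCone T C S) {α : Fin N → Y → ℝ} (hα : MultNonneg T α)
    (hαS : SlackDominated T C S α) {i : Fin N} {y : Y} (hy : y ∈ T.rivals i) : α i y ≤ C :=
  (Finset.single_le_sum (f := α i) (fun z hz => hα i z hz) hy).trans (hS.sum_le α hα hαS i)

/-- The dual problem has a solution as soon as it has a feasible point. -/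
theorem exists_solvesLaplaceDual {T : TrainingData X Y N} {f : X → Y → Fin K → ℝ}
    {lam C : ℝ} (hlam : 0 < lam) {S : Set (Fin N → ℝ)} (hS : IsSlackCone T C S)
    (hne : (dualSet T f lam C S).Nonempty) :
    ∃ α, SolvesLaplaceDual T f lam (dualSet T f lam C S) α := by
  -- Entries `α i y` with `y` not a rival are unconstrained and affect nothing; fixing them to `0`
  -- makes the domain compact even for infinite `Y`.
  set B : Set (Fin N → Y → ℝ) := Set.pi Set.univ fun i => Set.pi Set.univ fun y =>
    if y ∈ T.rivals i then Set.Icc (0 : ℝ) C else {0} with hB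
  have hBc : IsCompact B := isCompact_univ_pi fun i => isCompact_univ_pi fun y => by
    split_ifs
    · exact isCompact_Icc
    · exact isCompact_singleton
  have hetac : ∀ k, Continuous fun α => eta T f α k := fun k => continuous_pairing T _
  set D : Set (Fin N → Y → ℝ) := {α | SlackDominated T C S α ∧ ∀ k, eta T f α k ^ 2 ≤ lam}
  have hDc : IsClosed D := by
    have h1 : {α | SlackDominated T C S α} =
        ⋂ ξ ∈ S, {α | (pairing T α fun i _ => ξ i) ≤ linearSlack C ξ} := by
      ext α
      simp [SlackDominated]
    have h2 : {α | ∀ k, eta T f α k ^ 2 ≤ lam} = ⋂ k, {α | eta T f α k ^ 2 ≤ lam} := by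
      ext α
      simp
    refine IsClosed.inter (s₁ := {α | SlackDominated T C S α})
      (s₂ := {α | ∀ k, eta T f α k ^ 2 ≤ lam}) ?_ ?_
    · rw [h1]
      exact isClosed_biInter fun ξ _ => isClosed_le (continuous_pairing T _) continuous_const
    · rw [h2]
      exact isClosed_iInter fun k => isClosed_le ((hetac k).pow 2) continuous_const
  set g : (Fin N → Y → ℝ) → ℝ := fun α =>
    Real.exp (weightedLoss T α) * ∏ k, ((lam - eta T f α k ^ 2) / lam) with hg
  have hgc : Continuous g := by
    have h1 : Continuous fun α => weightedLoss T α := continuous_pairing T T.loss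
    exact (Real.continuous_exp.comp h1).mul (continuous_finsetProd _ fun k _ =>
      (continuous_const.sub ((hetac k).pow 2)).div_const _)
  have hrestrict : ∀ β ∈ dualSet T f lam C S, ∃ γ ∈ B ∩ D, γ ∈ dualSet T f lam C S ∧
      laplaceDualObjective T f lam γ = laplaceDualObjective T f lam β := by
    rintro β ⟨hβ, hβS, hβbox⟩
    set γ : Fin N → Y → ℝ := fun i y => if y ∈ T.rivals i then β i y else 0 with hγ
    have heq : ∀ i, ∀ y ∈ T.rivals i, γ i y = β i y := fun i y hy => if_pos hy
    have heta : ∀ k, eta T f γ k = eta T f β k := fun k => pairing_congr_left T heq _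
    have hγS : SlackDominated T C S γ := fun ξ hξ => by
      rw [pairing_congr_left T heq]
      exact hβS ξ hξ
    refine ⟨γ, ⟨fun i _ y _ => ?_, hγS, fun k => ?_⟩, ⟨fun i y hy => ?_, hγS, fun k => ?_⟩, ?_⟩
    · by_cases hy : y ∈ T.rivals i
      · simp only [hγ, hy, if_true]
        exact ⟨hβ i y hy, le_of_slackCone hS hβ hβS hy⟩
      · simp [hγ, hy]
    · rw [heta]
      exact (hβbox k).le
    · rw [heq i y hy]
      exact hβ i y hy
    · rw [heta]
      exact hβbox k
    · simp only [laplaceDualObjective, heta, weightedLoss_eq_pairing, pairing_congr_left T heq]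
  obtain ⟨β₀, hβ₀⟩ := hne
  obtain ⟨γ₀, hγ₀, hγ₀', -⟩ := hrestrict β₀ hβ₀
  obtain ⟨α, hα, hmax⟩ := (hBc.inter_right hDc).exists_isMaxOn ⟨γ₀, hγ₀⟩ hgc.continuousOn
  -- The maximizer does at least as well as a feasible point, where `g` is positive, so it avoids
  -- the boundary of the cube.
  have hpos : 0 < g α := by
    refine lt_of_lt_of_le ?_ (hmax hγ₀)
    rw [hg]
    simp only
    rw [← exp_laplaceDualObjective T f hlam hγ₀'.2.2]
    exact Real.exp_pos _
  have hbox : ∀ k, eta T f α k ^ 2 < lam := by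
    intro k
    refine lt_of_le_of_ne (hα.2.2 k) fun h => hpos.ne' ?_
    have : ∏ k, ((lam - eta T f α k ^ 2) / lam) = 0 :=
      Finset.prod_eq_zero (Finset.mem_univ k) (by rw [h]; simp)
    simp only [hg, this, mul_zero]
  refine ⟨α, ⟨fun i y hy => ?_, hα.2.1, hbox⟩, fun β hβ => ?_⟩
  · have := hα.1 i trivial y trivial
    simp only [hy, if_true] at this
    exact this.1
  · obtain ⟨γ, hγ, hγ', heq⟩ := hrestrict β hβ
    have h : g γ ≤ g α := hmax hγ
    simp only [hg] at h
    rw [← exp_laplaceDualObjective T f hlam hγ'.2.2, ← exp_laplaceDualObjective T f hlam hbox,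
      Real.exp_le_exp, heq] at h
    exact h

/-! ### Primal solutions and feasibility of the dual problem -/

theorem IsPrimalSolution.klDiv_ne_top {T : TrainingData X Y N} {f : X → Y → Fin K → ℝ}
    {lam C : ℝ} (hlam : 0 < lam) {S : Set (Fin N → ℝ)} (hS : IsSlackCone T C S)
    {P : Measure (Fin K → ℝ)} {ξ : Fin N → ℝ}
    (h : IsPrimalSolution T (linearDiscriminant f) (laplaceDensity lam) (linearSlack C) S P ξ) :
    klDiv P (prior (laplaceDensity lam)) ≠ ⊤ := by
  intro htop
  have h0 : ∀ k : Fin K, (0 : Fin K → ℝ) k ^ 2 < lam := fun _ => by simpa using hlam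
  obtain ⟨ζ, hζ, hc⟩ := hS.exists_feasible (marginExcess T f (laplaceTilt lam 0))
  have := h.2 (laplaceTilt lam 0) ζ ⟨admissible_laplaceTilt T f hlam h0, hζ, hc⟩
  rw [primalObjective_of_eq_top htop,
    primalObjective_of_ne_top (klDiv_laplaceTilt_prior hlam h0).1, top_le_iff] at this
  exact EReal.coe_ne_top _ this

/-- Otherwise a descent direction lowers the slack cost while `P` and feasibility are kept. -/
theorem IsPrimalSolution.exists_slackDominated {T : TrainingData X Y N}
    {f : X → Y → Fin K → ℝ}
    {lam C : ℝ} (hlam : 0 < lam) {S : Set (Fin N → ℝ)} (hS : IsSlackCone T C S)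
    {P : Measure (Fin K → ℝ)} {ξ : Fin N → ℝ}
    (h : IsPrimalSolution T (linearDiscriminant f) (laplaceDensity lam) (linearSlack C) S P ξ) :
    ∃ α, MultNonneg T α ∧ SlackDominated T C S α := by
  by_contra hno
  obtain ⟨d, hd, hdS, hd0⟩ := hS.exists_descent hno
  have hkl := h.klDiv_ne_top hlam hS
  have hfeas : PrimalFeasible T (linearDiscriminant f) S P (ξ + d) := by
    refine ⟨h.1.1, hdS ξ h.1.2.1, fun i y hy => ?_⟩
    have h1 := h.1.2.2 i y hy
    have h2 := hd0 i y hy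
    simp only [constraintValue, Pi.add_apply] at h1 ⊢
    linarith
  have := h.2 P (ξ + d) hfeas
  rw [primalObjective_of_ne_top hkl, primalObjective_of_ne_top hkl, EReal.coe_le_coe_iff,
    linearSlack_add] at this
  linarith

/-- A convex set that misses the open cube `{η | ∀ k, η_k² < lam}` is separated from it. -/
theorem exists_separation_of_disjoint_cube {lam : ℝ} (hlam : 0 < lam) {H : Set (Fin K → ℝ)}
    (hH : Convex ℝ H) (hne : H.Nonempty) (hdisj : ∀ η ∈ H, ¬ ∀ k, η k ^ 2 < lam) :
    ∃ v : Fin K → ℝ, v ≠ 0 ∧ ∀ η ∈ H, Real.sqrt lam * ∑ k, |v k| ≤ ∑ k, η k * v k := by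
  set Q : Set (Fin K → ℝ) :=
    Set.pi Set.univ fun _ => Set.Ioo (-Real.sqrt lam) (Real.sqrt lam) with hQ
  have hQmem : ∀ a : Fin K → ℝ, a ∈ Q ↔ ∀ k, a k ^ 2 < lam := fun a => by
    simp only [hQ, Set.mem_univ_pi, Set.mem_Ioo, sq_lt_iff_neg_sqrt_lt_and_lt_sqrt]
  obtain ⟨φ, u, h1, h2⟩ := geometric_hahn_banach_open (s := Q) (t := H)
    (convex_pi fun _ _ => convex_Ioo _ _) (isOpen_set_pi Set.finite_univ fun _ _ => isOpen_Ioo) hH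
    (Set.disjoint_left.2 fun a ha haH => hdisj a haH ((hQmem a).1 ha))
  have hφ : ∀ a : Fin K → ℝ, φ a = ∑ k, a k * φ (fun j => if k = j then 1 else 0) := fun a =>
    LinearMap.pi_apply_eq_sum_univ φ.toLinearMap a
  set v : Fin K → ℝ := fun k => φ (fun j => if k = j then 1 else 0) with hv
  have hu : 0 < u := by
    have := h1 0 ((hQmem 0).2 fun k => by simpa using hlam)
    rwa [map_zero] at this
  refine ⟨v, fun hv0 => ?_, fun η hη => ?_⟩
  · obtain ⟨b, hb⟩ := hne
    have := h2 b hb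
    have hb0 : φ b = 0 := by
      rw [hφ]
      exact Finset.sum_eq_zero fun k _ => by
        have : v k = 0 := congrFun hv0 k
        simp only [hv] at this
        rw [this, mul_zero]
    linarith
  · have hη' := h2 η hη
    rw [hφ] at hη'
    refine le_trans ?_ hη'
    by_contra hlt
    rw [not_le] at hlt
    set E := Real.sqrt lam * ∑ k, |v k| with hE
    have hE0 : 0 < E := hu.trans hlt
    have hr : u / E < 1 := (div_lt_one hE0).2 hlt
    have hr0 : 0 < u / E := div_pos hu hE0
    -- The corner `√lam * sign (v k)` of the cube has `φ`-value `E`. Scaled by `u / E < 1` it lies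
    -- in the open cube and has `φ`-value `u`, against the strict separation.
    have ha : (fun k => u / E * (Real.sqrt lam * SignType.sign (v k))) ∈ Q := by
      refine (hQmem _).2 fun k => ?_
      have hs : ((SignType.sign (v k) : ℝ)) ^ 2 ≤ 1 := by
        rcases lt_trichotomy (v k) 0 with h | h | h <;> simp [h]
      rw [mul_pow, mul_pow, Real.sq_sqrt hlam.le]
      have h3 : (u / E) ^ 2 < 1 := by nlinarith
      have h4 : lam * (SignType.sign (v k) : ℝ) ^ 2 ≤ lam := by nlinarith
      nlinarith [sq_nonneg (u / E)]
    have h5 := h1 _ ha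
    rw [hφ] at h5
    have h6 : ∑ k, u / E * (Real.sqrt lam * SignType.sign (v k)) * v k = u / E * E := by
      rw [hE, Finset.mul_sum, Finset.mul_sum]
      refine Finset.sum_congr rfl fun k _ => ?_
      rw [← sign_mul_self (v k)]
      ring
    have h7 := h6 ▸ h5
    rw [div_mul_cancel₀ _ hE0.ne'] at h7
    exact lt_irrefl _ h7

theorem weightedLoss_le {T : TrainingData X Y N} {C : ℝ} {S : Set (Fin N → ℝ)}
    (hS : IsSlackCone T C S) {α : Fin N → Y → ℝ} (hα : MultNonneg T α)
    (hαS : SlackDominated T C S α) :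
    weightedLoss T α ≤ ∑ i, ∑ y ∈ T.rivals i, C * |T.loss i y| :=
  Finset.sum_le_sum fun i _ => Finset.sum_le_sum fun y hy =>
    (mul_le_mul_of_nonneg_left (le_abs_self _) (hα i y hy)).trans
      (mul_le_mul_of_nonneg_right (le_of_slackCone hS hα hαS hy) (abs_nonneg _))

/-- If the primal problem has a solution, then the dual problem has a feasible point: otherwise the
primal objective is unbounded below along tilts of the prior with means on a separating ray. -/
theorem IsPrimalSolution.dualSet_nonempty {T : TrainingData X Y N} {f : X → Y → Fin K → ℝ}
    {lam C : ℝ} (hlam : 0 < lam) {S : Set (Fin N → ℝ)} (hS : IsSlackCone T C S)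
    {P : Measure (Fin K → ℝ)} {ξ : Fin N → ℝ}
    (h : IsPrimalSolution T (linearDiscriminant f) (laplaceDensity lam) (linearSlack C) S P ξ) :
    (dualSet T f lam C S).Nonempty := by
  by_contra hempty
  obtain ⟨α, hα, hαS⟩ := h.exists_slackDominated hlam hS
  have hkl := h.klDiv_ne_top hlam hS
  set A : Set (Fin N → Y → ℝ) := {β | MultNonneg T β ∧ SlackDominated T C S β} with hA
  have hconv : Convex ℝ (eta T f '' A) := by
    rintro _ ⟨β, hβ, rfl⟩ _ ⟨γ, hγ, rfl⟩ a b ha hb hab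
    refine ⟨a • β + b • γ, ⟨hβ.1.combination hγ.1 ha hb,
      hβ.2.combination hγ.2 ha hb hab⟩, funext fun k => ?_⟩
    simp [eta_combination]
  obtain ⟨v, hv, hsep⟩ := exists_separation_of_disjoint_cube hlam hconv ⟨_, α, ⟨hα, hαS⟩, rfl⟩ (by
    rintro _ ⟨β, hβ, rfl⟩ hbox
    exact hempty ⟨β, hβ.1, hβ.2, hbox⟩)
  -- The linear terms cancel by separation and the weighted loss is bounded by `weightedLoss_le`;
  -- this amount brings the primal value to at most the supposed optimum minus `1`.
  obtain ⟨t, ht, θ, hθ, hmean, hle⟩ := exists_tilt_mean_ray hlam hv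
    (∑ i, ∑ y ∈ T.rivals i, C * |T.loss i y| -
      ((klDiv P (prior (laplaceDensity lam))).toReal + linearSlack C ξ) + 1)
  obtain ⟨ζ, hζ, hc, β, hβ, hβS, heq⟩ :=
    hS.exists_slack α hα hαS (marginExcess T f (laplaceTilt lam θ))
  have hopt := h.2 (laplaceTilt lam θ) ζ ⟨admissible_laplaceTilt T f hlam hθ, hζ, hc⟩
  rw [primalObjective_of_ne_top hkl, primalObjective_of_ne_top (klDiv_laplaceTilt_prior hlam hθ).1,
    EReal.coe_le_coe_iff] at hopt
  rw [pairing_marginExcess_laplaceTilt T f hlam hθ] at heq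
  have hsum : ∑ k, eta T f β k * (2 * θ k / (lam - θ k ^ 2)) = t * ∑ k, eta T f β k * v k := by
    simp only [hmean, Finset.mul_sum]
    exact Finset.sum_congr rfl fun k _ => by ring
  have h1 := mul_le_mul_of_nonneg_left (hsep _ ⟨β, ⟨hβ, hβS⟩, rfl⟩) ht.le
  have h2 := weightedLoss_le hS hβ hβS
  rw [hsum] at heq
  linarith

/-! ### The two slack cones -/

theorem sum_ite_eq_mul {s : Finset Y} {z : Y} (hz : z ∈ s) (C : ℝ) (c : Y → ℝ) :
    ∑ y ∈ s, (if y = z then C else 0) * c y = C * c z := by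
  simp [ite_mul, Finset.sum_ite_eq', hz]

theorem sum_ite_eq_self {s : Finset Y} {z : Y} (hz : z ∈ s) (C : ℝ) :
    ∑ y ∈ s, (if y = z then C else 0) = C := by
  simp [Finset.sum_ite_eq', hz]

theorem linearSlack_single (C : ℝ) (i : Fin N) (r : ℝ) :
    linearSlack C (Pi.single i r) = C * r := by
  simp [linearSlack]

theorem slackDominated_univ_iff (T : TrainingData X Y N) (C : ℝ) (α : Fin N → Y → ℝ) :
    SlackDominated T C Set.univ α ↔ ∀ i, ∑ y ∈ T.rivals i, α i y = C := by
  -- Testing with both signs of a unit vector turns the inequality into an equality; on the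
  -- nonnegative cone only one sign is available.
  refine ⟨fun h i => ?_, fun h ξ _ => ?_⟩
  · have h1 := h (Pi.single i 1) trivial
    have h2 := h (Pi.single i (-1)) trivial
    rw [pairing_const, linearSlack_single] at h1 h2
    simp [Pi.single_apply] at h1 h2
    exact le_antisymm h1 h2
  · rw [pairing_const, linearSlack, Finset.mul_sum]
    simp only [h]
    exact le_rfl

theorem slackDominated_nonneg_iff (T : TrainingData X Y N) (C : ℝ) (α : Fin N → Y → ℝ) :
    SlackDominated T C {ξ | ∀ i, 0 ≤ ξ i} α ↔ ∀ i, ∑ y ∈ T.rivals i, α i y ≤ C := by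
  refine ⟨fun h i => ?_, fun h ξ hξ => ?_⟩
  · have h1 := h (Pi.single i 1) fun j => by
      rcases eq_or_ne j i with rfl | hj <;> simp [*]
    rw [pairing_const, linearSlack_single] at h1
    simpa [Pi.single_apply] using h1
  · rw [pairing_const, linearSlack, Finset.mul_sum]
    exact Finset.sum_le_sum fun i _ => mul_le_mul_of_nonneg_right (h i) (hξ i)

theorem dualSet_univ (T : TrainingData X Y N) (f : X → Y → Fin K → ℝ) (lam C : ℝ) :
    dualSet T f lam C Set.univ = laplaceDualSet T f lam C := by
  simp only [dualSet, slackDominated_univ_iff, laplaceDualSet]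

theorem dualSet_nonneg (T : TrainingData X Y N) (f : X → Y → Fin K → ℝ) (lam C : ℝ) :
    dualSet T f lam C {ξ | ∀ i, 0 ≤ ξ i} = laplaceDualSetLE T f lam C := by
  simp only [dualSet, slackDominated_nonneg_iff, laplaceDualSetLE]

theorem exists_nonneg_slack (T : TrainingData X Y N) (c : Fin N → Y → ℝ) :
    ∃ ξ : Fin N → ℝ, (∀ i, 0 ≤ ξ i) ∧ ∀ i, ∀ y ∈ T.rivals i, 0 ≤ c i y + ξ i := by
  refine ⟨fun i => ∑ y ∈ T.rivals i, |c i y|,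
    fun i => Finset.sum_nonneg fun y _ => abs_nonneg _, fun i y hy => ?_⟩
  have h1 := Finset.single_le_sum (f := fun y => |c i y|) (fun z _ => abs_nonneg _) hy
  have h2 := neg_abs_le (c i y)
  linarith

theorem linearSlack_sum_eq (T : TrainingData X Y N) {C : ℝ} {β c : Fin N → Y → ℝ}
    {ξ : Fin N → ℝ} (h : ∀ i, ∑ y ∈ T.rivals i, β i y * c i y = -(C * ξ i)) :
    pairing T β c = -linearSlack C ξ := by
  simp only [pairing, h, Finset.sum_neg_distrib, linearSlack, Finset.mul_sum]

theorem isSlackCone_univ (T : TrainingData X Y N) (C : ℝ) : IsSlackCone T C Set.univ where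
  zero_mem := trivial
  smul_mem _ _ _ _ := trivial
  sum_le α _ h i := ((slackDominated_univ_iff T C α).1 h i).le
  exists_slack := by
    intro α hα hαS c
    rw [slackDominated_univ_iff] at hαS
    have key : ∀ i, ∃ (r : ℝ) (b : Y → ℝ), (∀ y ∈ T.rivals i, 0 ≤ c i y + r) ∧
        (∀ y ∈ T.rivals i, 0 ≤ b y) ∧ ∑ y ∈ T.rivals i, b y = C ∧
        ∑ y ∈ T.rivals i, b y * c i y = -(C * r) := by
      intro i
      have hC : 0 ≤ C := hαS i ▸ Finset.sum_nonneg fun y hy => hα i y hy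
      rcases (T.rivals i).eq_empty_or_nonempty with he | he
      · have hC0 : C = 0 := by rw [← hαS i, he, Finset.sum_empty]
        exact ⟨0, 0, by simp [he], by simp, by simp [hC0], by simp⟩
      -- The cheapest slack for example `i` is `-min c_i`; the matching multiplier puts the whole
      -- mass `C` on a minimizing label.
      · obtain ⟨z, hz, hmin⟩ := Finset.exists_min_image _ (c i) he
        refine ⟨-c i z, fun y => if y = z then C else 0, fun y hy => ?_, fun y _ => ?_,
          sum_ite_eq_self hz C, ?_⟩
        · linarith [hmin y hy]
        · beta_reduce
          split_ifs
          exacts [hC, le_rfl]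
        · rw [sum_ite_eq_mul hz]
          ring
    choose ξ β h1 h2 h3 h4 using key
    exact ⟨ξ, trivial, h1, β, h2, (slackDominated_univ_iff T C β).2 h3, linearSlack_sum_eq T h4⟩
  exists_feasible c := by
    obtain ⟨ξ, -, h⟩ := exists_nonneg_slack T c
    exact ⟨ξ, trivial, h⟩
  exists_descent := by
    intro hno
    simp only [slackDominated_univ_iff] at hno
    rcases lt_or_ge C 0 with hC | hC
    · rcases isEmpty_or_nonempty (Fin N) with hN | ⟨⟨i⟩⟩
      · exact absurd ⟨0, fun i => hN.elim i, fun i => hN.elim i⟩ hno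
      · refine ⟨Pi.single i 1, by simpa [linearSlack_single] using hC, fun _ _ => trivial,
          fun j _ _ => ?_⟩
        rcases eq_or_ne j i with rfl | hj <;> simp [*]
    -- For `C ≥ 0` the sums can equal `C` unless an example has no rivals and `C ≠ 0`; its slack is
    -- then unconstrained and can be lowered.
    · have hex : ∃ i, T.rivals i = ∅ ∧ C ≠ 0 := by
        by_contra hall
        push Not at hall
        have key : ∀ i, ∃ b : Y → ℝ, (∀ y ∈ T.rivals i, 0 ≤ b y) ∧
            ∑ y ∈ T.rivals i, b y = C := by
          intro i
          rcases (T.rivals i).eq_empty_or_nonempty with he | ⟨z, hz⟩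
          · exact ⟨0, by simp, by simp [hall i he]⟩
          · refine ⟨fun y => if y = z then C else 0, fun y _ => ?_, sum_ite_eq_self hz C⟩
            beta_reduce
            split_ifs
            exacts [hC, le_rfl]
        choose β h1 h2 using key
        exact hno ⟨β, h1, h2⟩
      obtain ⟨i, hi, hC0⟩ := hex
      refine ⟨Pi.single i (-1), ?_, fun _ _ => trivial, fun j y hy => ?_⟩
      · rw [linearSlack_single]
        linarith [lt_of_le_of_ne hC hC0.symm]
      · rcases eq_or_ne j i with rfl | hj
        · simp [hi] at hy
        · simp [hj]

theorem isSlackCone_nonneg (T : TrainingData X Y N) (C : ℝ) :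
    IsSlackCone T C {ξ | ∀ i, 0 ≤ ξ i} where
  zero_mem _ := le_rfl
  smul_mem _ hξ _ ht i := mul_nonneg ht (hξ i)
  sum_le α _ h i := (slackDominated_nonneg_iff T C α).1 h i
  exists_slack := by
    intro α hα hαS c
    rw [slackDominated_nonneg_iff] at hαS
    have key : ∀ i, ∃ (r : ℝ) (b : Y → ℝ), 0 ≤ r ∧ (∀ y ∈ T.rivals i, 0 ≤ c i y + r) ∧
        (∀ y ∈ T.rivals i, 0 ≤ b y) ∧ ∑ y ∈ T.rivals i, b y ≤ C ∧
        ∑ y ∈ T.rivals i, b y * c i y = -(C * r) := by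
      intro i
      have hC : 0 ≤ C := (Finset.sum_nonneg fun y hy => hα i y hy).trans (hαS i)
      -- Here the cheapest slack is `max 0 (-min c_i)`; if no constraint is violated, both slack and
      -- multipliers are zero.
      by_cases hc : ∀ y ∈ T.rivals i, 0 ≤ c i y
      · exact ⟨0, 0, le_rfl, by simpa using hc, by simp, by simpa using hC, by simp⟩
      · push Not at hc
        obtain ⟨x, hx, hxneg⟩ := hc
        obtain ⟨z, hz, hmin⟩ := Finset.exists_min_image _ (c i) ⟨x, hx⟩
        refine ⟨-c i z, fun y => if y = z then C else 0, by linarith [hmin x hx],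
          fun y hy => ?_, fun y _ => ?_, (sum_ite_eq_self hz C).le, ?_⟩
        · linarith [hmin y hy]
        · beta_reduce
          split_ifs
          exacts [hC, le_rfl]
        · rw [sum_ite_eq_mul hz]
          ring
    choose ξ β h0 h1 h2 h3 h4 using key
    exact ⟨ξ, h0, h1, β, h2, (slackDominated_nonneg_iff T C β).2 h3, linearSlack_sum_eq T h4⟩
  exists_feasible c := exists_nonneg_slack T c
  exists_descent := by
    intro hno
    simp only [slackDominated_nonneg_iff] at hno
    rcases lt_or_ge C 0 with hC | hC
    · rcases isEmpty_or_nonempty (Fin N) with hN | ⟨⟨i⟩⟩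
      · exact absurd ⟨0, fun i => hN.elim i, fun i => hN.elim i⟩ hno
      · have hpos : ∀ j, (0 : ℝ) ≤ (Pi.single i 1 : Fin N → ℝ) j := fun j => by
          rcases eq_or_ne j i with rfl | hj <;> simp [*]
        exact ⟨Pi.single i 1, by simpa [linearSlack_single] using hC,
          fun ξ hξ j => add_nonneg (hξ j) (hpos j), fun j _ _ => hpos j⟩
    · exact absurd ⟨0, fun _ _ _ => le_rfl, fun i => by simpa using hC⟩ hno

end MaxEnDNet

open MaxEnDNet in
theorem theorem5 {X Y : Type*} [DecidableEq Y] {N K : ℕ} (T : TrainingData X Y N)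
    (f : X → Y → Fin K → ℝ) (lam C : ℝ) (hlam : 0 < lam) :
    -- the normalization factor of `p(w)`, finite exactly under the constraints `η_k² < lam`
    (∀ α : Fin N → Y → ℝ,
      ((∀ k, eta T f α k ^ 2 < lam) →
        normalizer T (linearDiscriminant f) (laplaceDensity lam) α =
          ENNReal.ofReal
            (Real.exp (-weightedLoss T α) * ∏ k, (lam / (lam - eta T f α k ^ 2)))) ∧
      ((¬ ∀ k, eta T f α k ^ 2 < lam) →
        normalizer T (linearDiscriminant f) (laplaceDensity lam) α = ⊤)) ∧
    -- slack variables in `ℝ^N`: the multipliers, the dual problem, and the optimal `p(w)`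
    (∀ α : Fin N → Y → ℝ,
      (IsDualSolution T (linearDiscriminant f) (laplaceDensity lam) (linearSlack C) Set.univ α ↔
        SolvesLaplaceDual T f lam (laplaceDualSet T f lam C) α) ∧
      (IsLagrangeMultiplier T (linearDiscriminant f) (laplaceDensity lam) (linearSlack C)
          Set.univ α ↔
        SolvesLaplaceDual T f lam (laplaceDualSet T f lam C) α) ∧
      (SolvesLaplaceDual T f lam (laplaceDualSet T f lam C) α →
        (∃ ξ, IsPrimalSolution T (linearDiscriminant f) (laplaceDensity lam) (linearSlack C)
          Set.univ (posterior T (linearDiscriminant f) (laplaceDensity lam) α) ξ) ∧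
        ∀ P ξ, IsPrimalSolution T (linearDiscriminant f) (laplaceDensity lam) (linearSlack C)
          Set.univ P ξ → P = posterior T (linearDiscriminant f) (laplaceDensity lam) α)) ∧
    (∀ P ξ, IsPrimalSolution T (linearDiscriminant f) (laplaceDensity lam) (linearSlack C)
        Set.univ P ξ → ∃ α, SolvesLaplaceDual T f lam (laplaceDualSet T f lam C) α) ∧
    -- slack variables restricted to `ξ ≥ 0`
    (∀ α : Fin N → Y → ℝ,
      (IsDualSolution T (linearDiscriminant f) (laplaceDensity lam) (linearSlack C)
          {ξ | ∀ i, 0 ≤ ξ i} α ↔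
        SolvesLaplaceDual T f lam (laplaceDualSetLE T f lam C) α) ∧
      (IsLagrangeMultiplier T (linearDiscriminant f) (laplaceDensity lam) (linearSlack C)
          {ξ | ∀ i, 0 ≤ ξ i} α ↔
        SolvesLaplaceDual T f lam (laplaceDualSetLE T f lam C) α) ∧
      (SolvesLaplaceDual T f lam (laplaceDualSetLE T f lam C) α →
        (∃ ξ, IsPrimalSolution T (linearDiscriminant f) (laplaceDensity lam) (linearSlack C)
          {ξ | ∀ i, 0 ≤ ξ i} (posterior T (linearDiscriminant f) (laplaceDensity lam) α) ξ) ∧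
        ∀ P ξ, IsPrimalSolution T (linearDiscriminant f) (laplaceDensity lam) (linearSlack C)
          {ξ | ∀ i, 0 ≤ ξ i} P ξ →
            P = posterior T (linearDiscriminant f) (laplaceDensity lam) α)) ∧
    (∀ P ξ, IsPrimalSolution T (linearDiscriminant f) (laplaceDensity lam) (linearSlack C)
        {ξ | ∀ i, 0 ≤ ξ i} P ξ → ∃ α, SolvesLaplaceDual T f lam (laplaceDualSetLE T f lam C) α) := by
  refine ⟨fun α => ⟨normalizer_laplace_of_lt T f hlam, normalizer_laplace_of_not_lt T f hlam⟩, ?_⟩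
  have hU := isSlackCone_univ T C
  have hN := isSlackCone_nonneg T C
  rw [← dualSet_univ, ← dualSet_nonneg]
  exact ⟨fun α => ⟨isDualSolution_iff hlam hU α, isLagrangeMultiplier_iff hlam hU α,
      primal_of_solves hlam hU⟩,
    fun P ξ h => exists_solvesLaplaceDual hlam hU (h.dualSet_nonempty hlam hU),
    fun α => ⟨isDualSolution_iff hlam hN α, isLagrangeMultiplier_iff hlam hN α,
      primal_of_solves hlam hN⟩,
    fun P ξ h => exists_solvesLaplaceDual hlam hN (h.dualSet_nonempty hlam hN)⟩
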